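/- **Setting.** Fix a finite family of constructor names $C$ and destructor names $D$, grouped into (possibly parametrised, mutually dependent) inductive types (given by their constructors) and coinductive types (given by their destructors), and a finite set of natural numbers called priorities; each instance of an inductive (coinductive) type has an odd (even) priority, carried by its constructors (records). Let $\mathcal V$ be the domain of finite and infinite values generated coinductively by $$v ::= \bot \mid x \mid C\,v \mid \{D_1=v_1;\dots;D_k=v_k\}$$ ($x$ an atom, i.e. an element of a type parameter), ordered contextually by $\bot\le v$; it is the ideal completion of the set of finite values. For a type $A$, $[\![A]\!]\subseteq\mathcal V$ is the subdomain of the values all of whose finite approximations have type $A$. A value is *total* if it contains no $\bot$ and the principal priority of each of its infinite branches is even (the principal priority is the largest priority that appears infinitely often; the statement also holds when it is the smallest one). A continuous function $[\![A]\!]\to[\![B]\!]$ is total if it sends total values to total values. Let $\mathcal S$ be the Smyth power domain of $\mathcal V$ with an added greatest element $0$, i.e. the ideal completion of the set of finite, possibly empty, formal sums of finite values preordered by $\sum_i u_i\le\sum_j v_j$ iff $\forall j\,\exists i,\ u_i\le v_j$; $0$ is the empty sum and sums are greatest lower bounds. An element of $\mathcal S$ is total if all its summands are total. Let $[\mathcal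 S\to\mathcal S]$ be the set of continuous functions $f$ with $f(0)=0$, ordered pointwise; its least element $\Omega$ sends $0$ to $0$ and all other elements to $\bot$. Such an $f$ is total if it sends total elements to total elements. For a continuous $f:[\![A]\!]\to[\![B]\!]$, $\widehat f\in[\mathcal S\to\mathcal S]$ is the continuous function that commutes with sums, with $\widehat f(v)=f(v)$ for $v\in[\![A]\!]$ and $\widehat f(v)=0$ for simple values $v\notin[\![A]\!]$. **Definitions by clauses.** A definition of $\mathtt f$ of type $A\to B$ is a finite ordered list of well-typed clauses $\mathtt f\,p=u$, where $p$ is a linear pattern of type $A$ (built from variables, constructors and full records) and $u$ is a term of type $B$ built from the variables of $p$, constructors, records, projections, calls to other functions $\mathtt g$ of type $A_{\mathtt g}\to B_{\mathtt g}$, and recursive calls to $\mathtt f$. A value is *refused* by $p$ if, where $p$ has a constructor or a record, the value has somewhere an atom, another constructor or a record of another shape; it *matches* $p$ if it has everywhere the constructors and records of $p$, and then $[p:=v]$ is the resulting substitution. (A value that is neither refused nor matched has $\bot$ somewhere where $p$ has a constructor or a record.) The clauses are assumed to be exhaustive: no element of $[\![A]\!]$ is refused by all of them. Let $\rho$ give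 a continuous function $\rho(\mathtt g):[\![A_{\mathtt g}]\!]\to[\![B_{\mathtt g}]\!]$ for each other function name, and let $\sigma$ give functions $\sigma(\mathtt g)\in[\mathcal S\to\mathcal S]$ with $\sigma(\mathtt g)\le\widehat{\rho(\mathtt g)}$, for example $\sigma=\widehat\rho$. * The standard operator $\Theta^{\mathrm{std}}$ acts on continuous $f:[\![A]\!]\to[\![B]\!]$: $\Theta^{\mathrm{std}}(f)(v)=[\![u[p:=v]]\!]_{\rho,\mathtt f:=f}$, where $\mathtt f\,p=u$ is the first clause that does not refuse $v$, if $v$ matches $p$; and $\Theta^{\mathrm{std}}(f)(v)=\bot$ if $v$ does not match that $p$. * The non-deterministic operator $\Theta^{\mathrm{nd}}$ acts on $[\mathcal S\to\mathcal S]$: $\Theta^{\mathrm{nd}}(f)$ is continuous, commutes with sums, and on simple values $\Theta^{\mathrm{nd}}(f)(v)$ is the sum over all clauses $\mathtt f\,p=u$ of $[\![u[p:=v]]\!]_{\sigma,\mathtt f:=f}$ if $v$ matches $p$, of $0$ if $v$ is refused by $p$, and of $\bot$ otherwise. (In $\mathcal S$, constructors and records are multilinear, and projection on $D$ is the linear map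 with $\bot\mapsto\bot$, $\{\dots;D=w;\dots\}\mapsto w$, and $v\mapsto 0$ for all other simple values.) **Statement.** If the fixed point $\bigsqcup_n(\Theta^{\mathrm{nd}})^n(\Omega):\mathcal S\to\mathcal S$ of the non-deterministic semantics is total, then the fixed point $\bigsqcup_n(\Theta^{\mathrm{std}})^n(\bot):[\![A]\!]\to[\![B]\!]$ of the standard semantics is total. -/

import Mathlib

open Order OmegaCompletePartialOrder

namespace Chariot

/-! ### Types -/

/-- Names of the inductive (`data`) and coinductive (`codata`) type definitions, with the number
of type parameters of each of them. -/
structure TyNames where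
  Data : Type
  Codata : Type
  dArity : Data → ℕ
  cArity : Codata → ℕ

/-- Type expressions over a set `X` of type parameters. -/
inductive Ty (N : TyNames) (X : Type) : Type
  | param (x : X) : Ty N X
  | data (T : N.Data) (args : Fin (N.dArity T) → Ty N X) : Ty N X
  | codata (T : N.Codata) (args : Fin (N.cArity T) → Ty N X) : Ty N X

/-- Substitution of the parameters of a type expression. -/
def Ty.subst {N : TyNames} {X Y : Type} (σ : X → Ty N Y) : Ty N X → Ty N Y
  | .param x => σ x
  | .data T args => .data T fun i => (args i).subst σ
  | .codata T args => .codata T fun i => (args i).subst σ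

/-- The type definitions and function names in scope.

* `Ctor T` is the set of constructors of the inductive type `T`; the constructor `c` has type
  `ctorTy T c → T(x₁, …, xₙ)`.
* `Field T` is the set of destructors of the coinductive type `T`; the destructor `d` has type
  `T(x₁, …, xₙ) → fieldTy T d`.
* `Param` are the type parameters that may occur in the types of functions. The elements of such a
  parameter `α` are arbitrary atoms, namely the `x : Atom` with `atomTy x = α`.
* `Prio` is the finite set of priorities. Each instance `T(τ₁, …, τₙ)` of an inductive
  (coinductive) type has an odd (even) priority, which is carried by its constructors (records).
* `Fn` are the names of the other functions, with their types. Each instance of a polymorphic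
  function counts as one name. -/
structure Lang extends TyNames where
  Ctor : Data → Type
  Field : Codata → Type
  finite_ctor : Finite (Σ T, Ctor T)
  finite_field : Finite (Σ T, Field T)
  ctorTy : ∀ T, Ctor T → Ty toTyNames (Fin (dArity T))
  fieldTy : ∀ T, Field T → Ty toTyNames (Fin (cArity T))
  Param : Type
  Atom : Type
  atomTy : Atom → Param
  Prio : Finset ℕ
  dataPrio : ∀ T, (Fin (dArity T) → Ty toTyNames Param) → {p : ℕ // p ∈ Prio ∧ Odd p}
  codataPrio : ∀ T, (Fin (cArity T) → Ty toTyNames Param) → {p : ℕ // p ∈ Prio ∧ Even p}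
  Fn : Type
  dom : Fn → Ty toTyNames Param
  cod : Fn → Ty toTyNames Param

namespace Lang

/-- The types in which functions are typed. -/
abbrev Typ (L : Lang) : Type := Ty L.toTyNames L.Param

/-- Constructor names. -/
abbrev Con (L : Lang) : Type := Σ T, L.Ctor T

/-- Destructor names (the field names of records). -/
abbrev Des (L : Lang) : Type := Σ T, L.Field T

abbrev OddPrio (L : Lang) : Type := {p : ℕ // p ∈ L.Prio ∧ Odd p}

abbrev EvenPrio (L : Lang) : Type := {p : ℕ // p ∈ L.Prio ∧ Even p}

instance (L : Lang) : Finite L.Con := L.finite_ctor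

instance (L : Lang) : Finite L.Des := L.finite_field

/-- The set of all the fields of a coinductive type. -/
def fields (L : Lang) (T : L.Codata) : Set L.Des := {d | d.1 = T}

/-- A destructor of `T`, as an element of `L.fields T`. -/
def field (L : Lang) (T : L.Codata) (d : L.Field T) : L.fields T := ⟨⟨T, d⟩, rfl⟩

/-- The type of the argument of the constructor `c` for the instance `T(args)`. -/
abbrev argTy (L : Lang) (T : L.Data) (args : Fin (L.dArity T) → L.Typ) (c : L.Ctor T) : L.Typ :=
  (L.ctorTy T c).subst args

/-- The type of the field `d` for the instance `T(args)`. -/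
abbrev resTy (L : Lang) (T : L.Codata) (args : Fin (L.cArity T) → L.Typ) (d : L.Field T) : L.Typ :=
  (L.fieldTy T d).subst args

end Lang

/-! ### Ideal completions -/

section Ideals

variable {P Q : Type} [Preorder P] [Preorder Q]

/-- The extension by continuity of a monotone function to the ideal completion. -/
def extend (F : P → Ideal Q) (hF : Monotone F) (I : Ideal P) : Ideal Q where
  carrier := {b | ∃ a ∈ I, b ∈ F a}
  lower' := by
    rintro b b' h ⟨a, ha, hb⟩
    exact ⟨a, ha, (F a).lower h hb⟩
  nonempty' := by
    obtain ⟨a, ha⟩ := I.nonempty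
    obtain ⟨b, hb⟩ := (F a).nonempty
    exact ⟨b, a, ha, hb⟩
  directed' := by
    rintro b ⟨a, ha, hb⟩ b' ⟨a', ha', hb'⟩
    obtain ⟨c, hc, h, h'⟩ := I.directed a ha a' ha'
    obtain ⟨e, he, h1, h2⟩ := (F c).directed b (hF h hb) b' (hF h' hb')
    exact ⟨e, ⟨c, hc, he⟩, h1, h2⟩

theorem mem_extend {F : P → Ideal Q} {hF : Monotone F} {I : Ideal P} {b : Q} :
    b ∈ extend F hF I ↔ ∃ a ∈ I, b ∈ F a := Iff.rfl

/-- The union of a non-empty directed set of ideals. -/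
def directedUnion (D : Set (Ideal P)) (hne : D.Nonempty) (hD : DirectedOn (· ≤ ·) D) :
    Ideal P where
  carrier := {a | ∃ I ∈ D, a ∈ I}
  lower' := by
    rintro b b' h ⟨I, hI, hb⟩
    exact ⟨I, hI, I.lower h hb⟩
  nonempty' := by
    obtain ⟨I, hI⟩ := hne
    obtain ⟨a, ha⟩ := I.nonempty
    exact ⟨a, I, hI, ha⟩
  directed' := by
    rintro b ⟨I, hI, hb⟩ b' ⟨J, hJ, hb'⟩
    obtain ⟨K, hK, h, h'⟩ := hD I hI J hJ
    obtain ⟨e, he, h1, h2⟩ := K.directed b (h hb) b' (h' hb')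
    exact ⟨e, ⟨K, hK, he⟩, h1, h2⟩

theorem mem_of_isLUB {D : Set (Ideal P)} (hne : D.Nonempty) (hD : DirectedOn (· ≤ ·) D)
    {I : Ideal P} (hI : IsLUB D I) {a : P} (ha : a ∈ I) : ∃ J ∈ D, a ∈ J :=
  (hI.2 (show directedUnion D hne hD ∈ upperBounds D from
    fun _ hJ _ hb => ⟨_, hJ, hb⟩) : I ≤ directedUnion D hne hD) ha

theorem scottContinuous_of_finitary {f : Ideal P → Ideal Q} (hm : Monotone f)
    (hf : ∀ I, ∀ b ∈ f I, ∃ a ∈ I, b ∈ f (Ideal.principal a)) : ScottContinuous f := by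
  intro D hne hD I hI
  refine ⟨?_, ?_⟩
  · rintro _ ⟨J, hJ, rfl⟩
    exact hm (hI.1 hJ)
  · intro K hK b hb
    obtain ⟨a, ha, hb⟩ := hf I b hb
    obtain ⟨J, hJ, haJ⟩ := mem_of_isLUB hne hD hI ha
    exact hK ⟨J, hJ, rfl⟩ (hm (Ideal.principal_le_iff.2 haJ) hb)

/-- Ideals are closed under suprema of increasing sequences. -/
instance : OmegaCompletePartialOrder (Ideal P) where
  ωSup c := directedUnion (Set.range c) (Set.range_nonempty c)
    (by
      rintro _ ⟨i, rfl⟩ _ ⟨j, rfl⟩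
      exact ⟨_, ⟨max i j, rfl⟩, c.monotone (le_max_left i j), c.monotone (le_max_right i j)⟩)
  le_ωSup c i := fun a ha => ⟨c i, ⟨i, rfl⟩, ha⟩
  ωSup_le := by
    rintro c x h a ⟨_, ⟨i, rfl⟩, ha⟩
    exact h i ha

theorem mem_ωSup {c : Chain (Ideal P)} {a : P} : a ∈ ωSup c ↔ ∃ i, a ∈ c i :=
  ⟨by rintro ⟨_, ⟨i, rfl⟩, h⟩; exact ⟨i, h⟩, fun ⟨i, h⟩ => ⟨c i, ⟨i, rfl⟩, h⟩⟩

end Ideals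

variable {L : Lang}

/-! ### Values -/

/-- Finite values: `⊥`, atoms, `C t`, and `{D₁ = t₁; …; Dₖ = tₖ}`, where constructors and records
carry a priority and the set of fields of a record is arbitrary. -/
inductive FinTree (L : Lang) : Type
  | bot : FinTree L
  | atom (x : L.Atom) : FinTree L
  | con (c : L.Con) (p : L.OddPrio) (t : FinTree L) : FinTree L
  | str (s : Set L.Des) (p : L.EvenPrio) (t : s → FinTree L) : FinTree L

namespace FinTree

/-- The contextual order generated by `⊥ ≤ t`. -/
inductive Le : FinTree L → FinTree L → Prop
  | bot (t : FinTree L) : Le .bot t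
  | atom (x : L.Atom) : Le (.atom x) (.atom x)
  | con (c : L.Con) (p : L.OddPrio) {t u : FinTree L} : Le t u → Le (.con c p t) (.con c p u)
  | str (s : Set L.Des) (p : L.EvenPrio) {t u : s → FinTree L} :
      (∀ d, Le (t d) (u d)) → Le (.str s p t) (.str s p u)

theorem Le.refl : ∀ t : FinTree L, Le t t
  | .bot => .bot _
  | .atom _ => .atom _
  | .con _ _ t => .con _ _ (Le.refl t)
  | .str _ _ t => .str _ _ fun d => Le.refl (t d)

theorem Le.trans' {t u : FinTree L} (h : Le t u) : ∀ {w}, Le u w → Le t w := by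
  induction h with
  | bot t => intro w _; exact .bot _
  | atom x => intro w h; exact h
  | con c p _ ih => intro w h; cases h with | con _ _ h => exact .con _ _ (ih h)
  | str s p _ ih => intro w h; cases h with | str _ _ h => exact .str _ _ fun d => ih d (h d)

instance : Preorder (FinTree L) where
  le := Le
  le_refl := Le.refl
  le_trans _ _ _ h h' := Le.trans' h h'

instance : OrderBot (FinTree L) where
  bot := .bot
  bot_le := Le.bot

theorem con_mono (c : L.Con) (p : L.OddPrio) : Monotone (FinTree.con c p) :=
  fun _ _ h => Le.con c p h

theorem str_mono (s : Set L.Des) (p : L.EvenPrio) : Monotone (FinTree.str s p) :=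
  fun _ _ h => Le.str s p h

theorem eq_bot_of_le_bot {t : FinTree L} (h : t ≤ .bot) : t = .bot := by
  change Le _ _ at h
  cases h
  rfl

/-- `t.HasType τ` when the finite value `t` belongs to the interpretation of `τ`. -/
def HasType : FinTree L → L.Typ → Prop
  | .bot, _ => True
  | .atom x, τ => τ = .param (L.atomTy x)
  | .con c p t, τ => ∃ args, τ = .data c.1 args ∧ p = L.dataPrio c.1 args ∧
      t.HasType (L.argTy c.1 args c.2)
  | .str s p t, τ => ∃ T args, ∃ h : s = L.fields T, τ = .codata T args ∧
      p = L.codataPrio T args ∧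
      ∀ d, (t ⟨(L.field T d).1, h ▸ (L.field T d).2⟩).HasType (L.resTy T args d)

theorem HasType.lower {t u : FinTree L} (h : Le t u) : ∀ {τ}, u.HasType τ → t.HasType τ := by
  induction h with
  | bot t => intro τ _; trivial
  | atom x => intro τ h; exact h
  | con c p _ ih =>
    rintro τ ⟨args, h1, h2, h3⟩
    exact ⟨args, h1, h2, ih h3⟩
  | str s p _ ih =>
    rintro τ ⟨T, args, h, h1, h2, h3⟩
    exact ⟨T, args, h, h1, h2, fun d => ih _ (h3 d)⟩

/-- A step along a branch of a value: `none` goes through a constructor and `some d` goes to the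
field `d` of a record. The priority that is met is recorded. -/
abbrev Step (L : Lang) : Type := Option L.Des × ℕ

/-- `At t l t'`: following `l` from the root of `t` leads to `t'`. -/
inductive At : FinTree L → List (Step L) → FinTree L → Prop
  | here (t : FinTree L) : At t [] t
  | con (c : L.Con) (p : L.OddPrio) {t t' : FinTree L} {l : List (Step L)} :
      At t l t' → At (.con c p t) ((none, p.1) :: l) t'
  | str (s : Set L.Des) (p : L.EvenPrio) {t : s → FinTree L} (d : s) {t' : FinTree L}
      {l : List (Step L)} : At (t d) l t' → At (.str s p t) ((some d.1, p.1) :: l) t'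

/-- Removing the constructor `c` (and `⊥` if there is no such constructor). -/
noncomputable def unCon (c : L.Con) (p : L.OddPrio) : FinTree L → FinTree L
  | .con c' p' t => open scoped Classical in if c' = c ∧ p' = p then t else .bot
  | _ => .bot

theorem unCon_mono (c : L.Con) (p : L.OddPrio) : Monotone (unCon c p) := by
  intro t u h
  change Le t u at h
  cases h with
  | bot t => exact Le.bot _
  | atom x => exact Le.refl _
  | con c' p' h =>
    simp only [unCon]
    split_ifs
    · exact h
    · exact Le.refl _
  | str => exact Le.refl _

/-- Projecting on the field `d` of a record with set of fields `s` (and `⊥` if there is no such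
record). -/
noncomputable def unStr (s : Set L.Des) (p : L.EvenPrio) (d : s) : FinTree L → FinTree L
  | .str s' p' t => open scoped Classical in
      if h : s = s' ∧ p = p' then t ⟨d.1, h.1 ▸ d.2⟩ else .bot
  | _ => .bot

theorem unStr_mono (s : Set L.Des) (p : L.EvenPrio) (d : s) : Monotone (unStr s p d) := by
  intro t u h
  change Le t u at h
  cases h with
  | bot t => exact Le.bot _
  | atom x => exact Le.refl _
  | con c' p' h => exact Le.refl _
  | str s' p' h =>
    simp only [unStr]
    split_ifs
    · exact h _
    · exact Le.refl _

theorem HasType.unCon {T : L.Data} {args : Fin (L.dArity T) → L.Typ} (c : L.Ctor T)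
    {t : FinTree L} (h : t.HasType (.data T args)) :
    (t.unCon ⟨T, c⟩ (L.dataPrio T args)).HasType (L.argTy T args c) := by
  cases t with
  | con c' p' t =>
    simp only [FinTree.unCon]
    split_ifs with hc
    · obtain ⟨rfl, rfl⟩ := hc
      obtain ⟨args', h1, -, h3⟩ := h
      cases h1
      exact h3
    · trivial
  | _ => trivial

theorem HasType.unStr {T : L.Codata} {args : Fin (L.cArity T) → L.Typ} (d : L.Field T)
    {t : FinTree L} (h : t.HasType (.codata T args)) :
    (t.unStr (L.fields T) (L.codataPrio T args) (L.field T d)).HasType (L.resTy T args d) := by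
  cases t with
  | str s p t =>
    simp only [FinTree.unStr]
    split_ifs with hc
    · obtain ⟨T', args', hs, h1, -, h3⟩ := h
      cases h1
      exact h3 d
    · trivial
  | _ => trivial

end FinTree

/-- The domain `𝒱` of all finite and infinite values, as the ideal completion of the finite ones:
a value is given by the set of its finite approximations. -/
abbrev Val (L : Lang) : Type := Ideal (FinTree L)

namespace Val

/-- `C v`. -/
def con (c : L.Con) (p : L.OddPrio) : Val L → Val L :=
  extend (fun t => Ideal.principal (.con c p t))
    fun _ _ h => Ideal.principal_le_iff.2 (FinTree.con_mono c p h)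

/-- `{D₁ = v₁; …; Dₖ = vₖ}`. -/
def str (s : Set L.Des) (p : L.EvenPrio) (v : s → Val L) : Val L where
  carrier := {b | ∃ a : s → FinTree L, (∀ d, a d ∈ v d) ∧ b ≤ .str s p a}
  lower' := by
    rintro b b' h ⟨a, ha, hb⟩
    exact ⟨a, ha, le_trans h hb⟩
  nonempty' := ⟨.bot, fun _ => ⊥, fun d => Ideal.bot_mem (v d), bot_le⟩
  directed' := by
    rintro b ⟨a, ha, hb⟩ b' ⟨a', ha', hb'⟩
    choose e he h h' using fun d => (v d).directed (a d) (ha d) (a' d) (ha' d)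
    exact ⟨.str s p e, ⟨e, he, le_rfl⟩, hb.trans (FinTree.str_mono s p h),
      hb'.trans (FinTree.str_mono s p h')⟩

/-- `C⁻ v` (only used on values that are `⊥` or start with `C`). -/
noncomputable def unCon (c : L.Con) (p : L.OddPrio) : Val L → Val L :=
  extend (fun t => Ideal.principal (t.unCon c p))
    fun _ _ h => Ideal.principal_le_iff.2 (FinTree.unCon_mono c p h)

/-- The field `d` of a record (only used on values that are `⊥` or records with fields `s`). -/
noncomputable def unStr (s : Set L.Des) (p : L.EvenPrio) (d : s) : Val L → Val L :=
  extend (fun t => Ideal.principal (t.unStr s p d))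
    fun _ _ h => Ideal.principal_le_iff.2 (FinTree.unStr_mono s p d h)

end Val

/-- The two usual conventions for the principal priority of an infinite branch: the largest, or
the smallest, of the priorities that appear infinitely often. -/
inductive Convention
  | largest
  | smallest

/-- `κ.Principal b p`: `p` is the principal priority of the sequence of priorities `b`. -/
def Convention.Principal (κ : Convention) (b : ℕ → ℕ) (p : ℕ) : Prop :=
  (∃ᶠ n in Filter.atTop, b n = p) ∧
    ∀ q, (∃ᶠ n in Filter.atTop, b n = q) →
      match κ with
      | .largest => q ≤ p
      | .smallest => p ≤ q

/-- An infinite branch of a value. -/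
def Val.IsBranch (v : Val L) (b : ℕ → FinTree.Step L) : Prop :=
  ∀ n, ∃ a ∈ v, ∃ t, FinTree.At a (List.ofFn fun i : Fin n => b i) t

/-- A value is total if it does not contain `⊥` (every position of the value carries an atom, a
constructor or a record) and each of its infinite branches has an even principal priority. -/
def Val.Total (κ : Convention) (v : Val L) : Prop :=
  (∀ l, ∀ a ∈ v, FinTree.At a l .bot → ∃ a' ∈ v, ∃ t, FinTree.At a' l t ∧ t ≠ .bot) ∧
    ∀ b, v.IsBranch b → ∃ p, κ.Principal (fun n => (b n).2) p ∧ Even p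

/-! ### Interpretation of types -/

/-- The interpretation `⟦τ⟧` of a type, a subdomain of `𝒱`. -/
structure Den (τ : L.Typ) where
  val : Val L
  hasType : ∀ a ∈ val, a.HasType τ

namespace Den

instance (τ : L.Typ) : PartialOrder (Den τ) :=
  PartialOrder.lift Den.val fun v w h => by cases v; cases w; cases h; rfl

instance (τ : L.Typ) : OrderBot (Den τ) where
  bot := ⟨⊥, by
    intro a ha
    rw [FinTree.eq_bot_of_le_bot ha]
    trivial⟩
  bot_le v := (bot_le : ⊥ ≤ v.1)

instance (τ : L.Typ) : OmegaCompletePartialOrder (Den τ) where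
  ωSup c := ⟨ωSup (c.map ⟨Den.val, fun _ _ h => h⟩), by
    intro a ha
    obtain ⟨i, hi⟩ := mem_ωSup.1 ha
    exact (c i).2 a hi⟩
  le_ωSup c i := le_ωSup (c.map ⟨Den.val, fun _ _ h => h⟩) i
  ωSup_le c x h := ωSup_le (c.map ⟨Den.val, fun _ _ h => h⟩) x.1 h

/-- A finite value, as an element of the interpretation of its type. -/
def fin {τ : L.Typ} (a : FinTree L) (h : a.HasType τ) : Den τ :=
  ⟨Ideal.principal a, fun _ hb => h.lower hb⟩

theorem fin_le {τ : L.Typ} {a : FinTree L} {h : a.HasType τ} {v : Den τ} :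
    fin a h ≤ v ↔ a ∈ v.1 := Ideal.principal_le_iff

theorem mem_of_isLUB {τ : L.Typ} {D : Set (Den τ)} (hne : D.Nonempty)
    (hD : DirectedOn (· ≤ ·) D) {v : Den τ} (hv : IsLUB D v) {a : FinTree L} (ha : a ∈ v.1) :
    ∃ w ∈ D, a ∈ w.1 := by
  let U : Den τ := ⟨directedUnion (Den.val '' D) (hne.image _)
      (by
        rintro _ ⟨x, hx, rfl⟩ _ ⟨y, hy, rfl⟩
        obtain ⟨z, hz, h1, h2⟩ := hD x hx y hy
        exact ⟨z.1, ⟨z, hz, rfl⟩, h1, h2⟩), by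
    rintro b ⟨_, ⟨w, _, rfl⟩, hb⟩
    exact w.2 b hb⟩
  have h : v ≤ U := hv.2 fun w hw b hb => ⟨w.1, ⟨w, hw, rfl⟩, hb⟩
  obtain ⟨_, ⟨w, hw, rfl⟩, hb⟩ := h ha
  exact ⟨w, hw, hb⟩

/-- Scott continuous functions are determined by finite approximations. -/
theorem finitary {τ τ' : L.Typ} {f : Den τ → Den τ'} (hf : ScottContinuous f) (v : Den τ)
    {b : FinTree L} (hb : b ∈ (f v).1) : ∃ a, ∃ h : a ∈ v.1, b ∈ (f (fin a (v.2 a h))).1 := by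
  let D : Set (Den τ) := {w | ∃ a, ∃ h : a ∈ v.1, w = fin a (v.2 a h)}
  have hne : D.Nonempty := ⟨_, ⊥, Ideal.bot_mem v.1, rfl⟩
  have hD : DirectedOn (· ≤ ·) D := by
    rintro _ ⟨a, ha, rfl⟩ _ ⟨a', ha', rfl⟩
    obtain ⟨e, he, h, h'⟩ := v.1.directed a ha a' ha'
    exact ⟨_, ⟨e, he, rfl⟩, fin_le.2 h, fin_le.2 h'⟩
  have hv : IsLUB D v := by
    refine ⟨?_, ?_⟩
    · rintro _ ⟨a, ha, rfl⟩
      exact fin_le.2 ha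
    · intro w hw a ha
      exact fin_le.1 (hw ⟨a, ha, rfl⟩)
  have hd : DirectedOn (· ≤ ·) (f '' D) := by
    rintro _ ⟨x, hx, rfl⟩ _ ⟨y, hy, rfl⟩
    obtain ⟨z, hz, h1, h2⟩ := hD x hx y hy
    exact ⟨f z, ⟨z, hz, rfl⟩, hf.monotone h1, hf.monotone h2⟩
  obtain ⟨_, ⟨_, ⟨a, ha, rfl⟩, rfl⟩, h⟩ := mem_of_isLUB (hne.image f) hd (hf hne hD hv) hb
  exact ⟨a, ha, h⟩

theorem scottContinuous_of_finitary {τ τ' : L.Typ} {f : Den τ → Den τ'} (hm : Monotone f)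
    (hf : ∀ v : Den τ, ∀ b ∈ (f v).1, ∃ a, ∃ h : a ∈ v.1, b ∈ (f (fin a (v.2 a h))).1) :
    ScottContinuous f := by
  intro D hne hD v hv
  refine ⟨?_, ?_⟩
  · rintro _ ⟨w, hw, rfl⟩
    exact hm (hv.1 hw)
  · intro w hw b hb
    obtain ⟨a, ha, hb⟩ := hf v b hb
    obtain ⟨x, hx, hax⟩ := mem_of_isLUB hne hD hv ha
    exact hw ⟨x, hx, rfl⟩ (hm (fin_le.2 hax) hb)

/-- Constructors, on typed values. -/
def con (T : L.Data) (args : Fin (L.dArity T) → L.Typ) (c : L.Ctor T)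
    (v : Den (L.argTy T args c)) : Den (.data T args) :=
  ⟨Val.con ⟨T, c⟩ (L.dataPrio T args) v.1, by
    rintro b ⟨a, ha, hb⟩
    exact FinTree.HasType.lower hb ⟨args, rfl, rfl, v.2 a ha⟩⟩

/-- Records, on typed values: all the fields of the type are given. -/
def str (T : L.Codata) (args : Fin (L.cArity T) → L.Typ)
    (v : ∀ d : L.Field T, Den (L.resTy T args d)) : Den (.codata T args) :=
  ⟨Val.str (L.fields T) (L.codataPrio T args)
      (fun d => (v (d.2 ▸ d.1.2)).1), by
    rintro b ⟨a, ha, hb⟩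
    exact FinTree.HasType.lower hb ⟨T, args, rfl, rfl, rfl, fun d => (v d).2 _ (ha (L.field T d))⟩⟩

/-- Destructors, on typed values. -/
noncomputable def proj (T : L.Codata) (args : Fin (L.cArity T) → L.Typ) (d : L.Field T)
    (v : Den (.codata T args)) : Den (L.resTy T args d) :=
  ⟨Val.unStr (L.fields T) (L.codataPrio T args) (L.field T d) v.1, by
    rintro b ⟨a, ha, hb⟩
    exact FinTree.HasType.lower hb ((v.2 a ha).unStr d)⟩

/-- The argument of a constructor, on typed values. -/
noncomputable def unCon (T : L.Data) (args : Fin (L.dArity T) → L.Typ) (c : L.Ctor T)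
    (v : Den (.data T args)) : Den (L.argTy T args c) :=
  ⟨Val.unCon ⟨T, c⟩ (L.dataPrio T args) v.1, by
    rintro b ⟨a, ha, hb⟩
    exact FinTree.HasType.lower hb ((v.2 a ha).unCon c)⟩

end Den

/-- The domain of continuous functions `⟦A⟧ → ⟦B⟧`. -/
structure DenFun (A B : L.Typ) where
  toFun : Den A → Den B
  cont : ScottContinuous toFun

namespace DenFun

variable {A B : L.Typ}

/-- The pointwise order. -/
instance : PartialOrder (DenFun A B) :=
  PartialOrder.lift DenFun.toFun fun f g h => by cases f; cases g; cases h; rfl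

instance : OrderBot (DenFun A B) where
  bot := ⟨fun _ => ⊥, ScottContinuous.const ⊥⟩
  bot_le f := fun v => (bot_le : ⊥ ≤ f.toFun v)

/-- Suprema of increasing sequences are computed pointwise. -/
instance : OmegaCompletePartialOrder (DenFun A B) where
  ωSup c := ⟨fun v => ωSup (c.map ⟨fun f => f.toFun v, fun _ _ h => h v⟩),
    Den.scottContinuous_of_finitary
      (by
        intro v w h b hb
        obtain ⟨i, hi⟩ := mem_ωSup.1 hb
        exact mem_ωSup.2 ⟨i, (c i).cont.monotone h hi⟩)
      (by
        intro v b hb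
        obtain ⟨i, hi⟩ := mem_ωSup.1 hb
        obtain ⟨a, ha, h⟩ := Den.finitary (c i).cont v hi
        exact ⟨a, ha, mem_ωSup.2 ⟨i, h⟩⟩)⟩
  le_ωSup c i := fun v => le_ωSup (c.map ⟨fun f => f.toFun v, fun _ _ h => h v⟩) i
  ωSup_le c x h := fun v => ωSup_le (c.map ⟨fun f => f.toFun v, fun _ _ h => h v⟩) _
    fun i => h i v

/-- A function is total if it sends total values to total values. -/
def Total (κ : Convention) (f : DenFun A B) : Prop :=
  ∀ v : Den A, v.1.Total κ → (f.toFun v).1.Total κ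

end DenFun

/-! ### The domain of formal sums -/

/-- Finite formal sums of finite values, including the empty sum. -/
structure FinSum (L : Lang) where
  terms : Finset (FinTree L)

namespace FinSum

/-- `∑ᵢ uᵢ ≤ ∑ⱼ vⱼ` iff for all `j`, there is some `i` with `uᵢ ≤ vⱼ`. -/
instance : Preorder (FinSum L) where
  le A B := ∀ b ∈ B.terms, ∃ a ∈ A.terms, a ≤ b
  le_refl A a ha := ⟨a, ha, le_rfl⟩
  le_trans A B C h h' c hc := by
    obtain ⟨b, hb, hbc⟩ := h' c hc
    obtain ⟨a, ha, hab⟩ := h b hb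
    exact ⟨a, ha, hab.trans hbc⟩

/-- The empty sum is the greatest element. -/
instance : OrderTop (FinSum L) where
  top := ⟨∅⟩
  le_top _ b hb := absurd hb (Finset.notMem_empty b)

instance : OrderBot (FinSum L) where
  bot := ⟨{⊥}⟩
  bot_le _ _ _ := ⟨⊥, Finset.mem_singleton_self _, bot_le⟩

instance : IsDirectedOrder (FinSum L) := ⟨fun _ _ => ⟨⊤, le_top, le_top⟩⟩

/-- A simple sum. -/
def single (a : FinTree L) : FinSum L := ⟨{a}⟩

theorem single_mono : Monotone (single : FinTree L → FinSum L) := by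
  intro a a' h b hb
  obtain rfl := Finset.mem_singleton.1 hb
  exact ⟨a, Finset.mem_singleton_self _, h⟩

/-- The sum of a finite family of sums. -/
noncomputable def sum {ι : Type} [Finite ι] (A : ι → FinSum L) : FinSum L :=
  open scoped Classical in
  letI := Fintype.ofFinite ι
  ⟨Finset.univ.biUnion fun i => (A i).terms⟩

theorem sum_le {ι : Type} [Finite ι] (A : ι → FinSum L) (i : ι) : sum A ≤ A i := by
  classical
  intro b hb
  exact ⟨b, by simpa [sum] using ⟨i, hb⟩, le_rfl⟩

theorem le_sum {ι : Type} [Finite ι] {A : ι → FinSum L} {B : FinSum L} (h : ∀ i, B ≤ A i) :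
    B ≤ sum A := by
  classical
  intro b hb
  obtain ⟨i, hi⟩ : ∃ i, b ∈ (A i).terms := by simpa [sum] using hb
  exact h i b hi

/-- Records are multilinear:
`{…; Dᵢ = ∑ⱼ uᵢⱼ; …}` is the sum of all the records `{…; Dᵢ = uᵢⱼ; …}`. -/
noncomputable def str (s : Set L.Des) (p : L.EvenPrio) (A : s → FinSum L) : FinSum L :=
  open scoped Classical in
  letI := Fintype.ofFinite s
  ⟨(Fintype.piFinset fun d => (A d).terms).image (FinTree.str s p)⟩

theorem mem_str {s : Set L.Des} {p : L.EvenPrio} {A : s → FinSum L} {t : FinTree L} :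
    t ∈ (str s p A).terms ↔ ∃ a, (∀ d, a d ∈ (A d).terms) ∧ FinTree.str s p a = t := by
  classical
  simp [str, Fintype.mem_piFinset]

theorem str_mono (s : Set L.Des) (p : L.EvenPrio) :
    Monotone (str s p : (s → FinSum L) → FinSum L) := by
  intro A B h t ht
  obtain ⟨b, hb, rfl⟩ := mem_str.1 ht
  choose a ha hab using fun d => h d (b d) (hb d)
  exact ⟨_, mem_str.2 ⟨a, ha, rfl⟩, FinTree.str_mono s p hab⟩

end FinSum

/-- The domain `𝒮`: the Smyth power domain over `𝒱` with a greatest element `𝟎 = ⊤` (the empty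
sum), as the ideal completion of the preorder of finite sums of finite values. -/
abbrev Sums (L : Lang) : Type := Ideal (FinSum L)

namespace Sums

/-- The simple value `v`, as an element of `𝒮`. -/
def simple : Val L → Sums L :=
  extend (fun a => Ideal.principal (FinSum.single a))
    fun _ _ h => Ideal.principal_le_iff.2 (FinSum.single_mono h)

/-- `v` is one of the terms of the formal sum `K` (or lies above one of its terms), that is `v` is
a simple value above `K`. -/
def Summand (v : Val L) (K : Sums L) : Prop := K ≤ simple v

/-- An element of `𝒮` is total if all its summands are total (total values being maximal, it does
not matter if the values that lie above the summands are also considered). -/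
def Total (κ : Convention) (K : Sums L) : Prop := ∀ v, Summand v K → v.Total κ

/-- Finite sums in `𝒮`: the greatest lower bound of a finite family. -/
noncomputable def sum {ι : Type} [Finite ι] (K : ι → Sums L) : Sums L where
  carrier := {B | ∀ i, B ∈ K i}
  lower' := fun _ _ h hB i => (K i).lower h (hB i)
  nonempty' := ⟨⊥, fun i => Ideal.bot_mem (K i)⟩
  directed' := by
    intro B hB B' hB'
    choose C hC h h' using fun i => (K i).directed B (hB i) B' (hB' i)
    exact ⟨FinSum.sum C, fun i => (K i).lower (FinSum.sum_le C i) (hC i),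
      FinSum.le_sum h, FinSum.le_sum h'⟩

theorem sum_isGLB {ι : Type} [Finite ι] (K : ι → Sums L) : IsGLB (Set.range K) (sum K) :=
  ⟨by rintro _ ⟨i, rfl⟩ B hB; exact hB i, fun _ hJ _ hB i => hJ ⟨i, rfl⟩ hB⟩

theorem sum_mono {ι : Type} [Finite ι] {K K' : ι → Sums L} (h : ∀ i, K i ≤ K' i) :
    sum K ≤ sum K' := fun _ hB i => h i (hB i)

/-- The linear extension to finite sums of finite values. -/
noncomputable def linFin (F : FinTree L → Sums L) (A : FinSum L) : Sums L :=
  sum fun a : {a // a ∈ A.terms} => F a.1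

theorem linFin_mono {F : FinTree L → Sums L} (hF : Monotone F) : Monotone (linFin F) := by
  intro A A' h B hB a'
  obtain ⟨a, ha, haa'⟩ := h a'.1 a'.2
  exact hF haa' (hB ⟨a, ha⟩)

/-- Records of sums. -/
noncomputable def str (s : Set L.Des) (p : L.EvenPrio) (K : s → Sums L) : Sums L where
  carrier := {B | ∃ A : s → FinSum L, (∀ d, A d ∈ K d) ∧ B ≤ FinSum.str s p A}
  lower' := by
    rintro B B' h ⟨A, hA, hB⟩
    exact ⟨A, hA, le_trans h hB⟩
  nonempty' := ⟨⊥, fun _ => ⊥, fun d => Ideal.bot_mem (K d), bot_le⟩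
  directed' := by
    rintro B ⟨A, hA, hB⟩ B' ⟨A', hA', hB'⟩
    choose E hE h h' using fun d => (K d).directed (A d) (hA d) (A' d) (hA' d)
    exact ⟨FinSum.str s p E, ⟨E, hE, le_rfl⟩, hB.trans (FinSum.str_mono s p h),
      hB'.trans (FinSum.str_mono s p h')⟩

theorem str_le (s : Set L.Des) (p : L.EvenPrio) {K K' : s → Sums L} (h : ∀ d, K d ≤ K' d) :
    str s p K ≤ str s p K' := by
  rintro B ⟨A, hA, hB⟩
  exact ⟨A, fun d => h d (hA d), hB⟩

end Sums

/-- The domain `[𝒮 → 𝒮]` of continuous functions that propagate errors. -/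
structure SumsFun (L : Lang) where
  toFun : Sums L → Sums L
  cont : ScottContinuous toFun
  map_top : toFun ⊤ = ⊤

namespace SumsFun

/-- The pointwise order. -/
instance : PartialOrder (SumsFun L) :=
  PartialOrder.lift SumsFun.toFun fun f g h => by cases f; cases g; cases h; rfl

theorem finitary (f : SumsFun L) (K : Sums L) {B : FinSum L} (hB : B ∈ f.toFun K) :
    ∃ A ∈ K, B ∈ f.toFun (Ideal.principal A) := by
  let D : Set (Sums L) := {J | ∃ A ∈ K, J = Ideal.principal A}
  have hne : D.Nonempty := ⟨_, ⊥, Ideal.bot_mem K, rfl⟩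
  have hD : DirectedOn (· ≤ ·) D := by
    rintro _ ⟨a, ha, rfl⟩ _ ⟨a', ha', rfl⟩
    obtain ⟨e, he, h, h'⟩ := K.directed a ha a' ha'
    exact ⟨_, ⟨e, he, rfl⟩, Ideal.principal_le_iff.2 h, Ideal.principal_le_iff.2 h'⟩
  have hv : IsLUB D K := by
    refine ⟨?_, ?_⟩
    · rintro _ ⟨a, ha, rfl⟩
      exact Ideal.principal_le_iff.2 ha
    · intro w hw a ha
      exact Ideal.principal_le_iff.1 (hw ⟨a, ha, rfl⟩)
  have hd : DirectedOn (· ≤ ·) (f.toFun '' D) := by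
    rintro _ ⟨x, hx, rfl⟩ _ ⟨y, hy, rfl⟩
    obtain ⟨z, hz, h1, h2⟩ := hD x hx y hy
    exact ⟨f.toFun z, ⟨z, hz, rfl⟩, f.cont.monotone h1, f.cont.monotone h2⟩
  obtain ⟨_, ⟨_, ⟨a, ha, rfl⟩, rfl⟩, h⟩ := mem_of_isLUB (hne.image _) hd (f.cont hne hD hv) hB
  exact ⟨a, ha, h⟩

/-- Suprema of increasing sequences are computed pointwise. -/
instance : OmegaCompletePartialOrder (SumsFun L) where
  ωSup c := ⟨fun K => ωSup (c.map ⟨fun f => f.toFun K, fun _ _ h => h K⟩),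
    scottContinuous_of_finitary
      (by
        intro v w h b hb
        obtain ⟨i, hi⟩ := mem_ωSup.1 hb
        exact mem_ωSup.2 ⟨i, (c i).cont.monotone h hi⟩)
      (by
        intro v b hb
        obtain ⟨i, hi⟩ := mem_ωSup.1 hb
        obtain ⟨a, ha, h⟩ := (c i).finitary v hi
        exact ⟨a, ha, mem_ωSup.2 ⟨i, h⟩⟩),
    top_le_iff.1 fun b _ => mem_ωSup.2 ⟨0, by
      change b ∈ (c 0).toFun ⊤
      rw [(c 0).map_top]
      trivial⟩⟩
  le_ωSup c i := fun K => le_ωSup (c.map ⟨fun f => f.toFun K, fun _ _ h => h K⟩) i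
  ωSup_le c x h := fun K => ωSup_le (c.map ⟨fun f => f.toFun K, fun _ _ h => h K⟩) _
    fun i => h i K

/-- The linear function on `𝒮` that extends, by continuity, a monotone function on finite
values: `lin F (∑ v) = ∑ F v`. -/
noncomputable def lin (F : FinTree L → Sums L) (hF : Monotone F) : SumsFun L where
  toFun := extend (Sums.linFin F) (Sums.linFin_mono hF)
  cont := scottContinuous_of_finitary
    (by
      rintro I J h B ⟨A, hA, hB⟩
      exact ⟨A, h hA, hB⟩)
    (by
      rintro I B ⟨A, hA, hB⟩
      exact ⟨A, hA, A, Ideal.mem_principal_self, hB⟩)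
  map_top := top_le_iff.1 fun _ _ => ⟨⊤, trivial, fun a => absurd a.2 (Finset.notMem_empty _)⟩

theorem lin_mono {F G : FinTree L → Sums L} {hF : Monotone F} {hG : Monotone G}
    (h : ∀ a, F a ≤ G a) : lin F hF ≤ lin G hG := by
  rintro K B ⟨A, hA, hB⟩
  exact ⟨A, hA, fun a => h a.1 (hB a)⟩

/-- `lin F` extends `F` to infinite simple values by continuity. -/
theorem lin_simple (F : FinTree L → Sums L) (hF : Monotone F) (v : Val L) :
    (lin F hF).toFun (Sums.simple v) = extend F hF v := by
  refine le_antisymm ?_ ?_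
  · rintro B ⟨A, ⟨a, ha, hAa⟩, hB⟩
    obtain ⟨a', ha', h⟩ := hAa a (Finset.mem_singleton_self a)
    exact ⟨a, ha, hF h (hB ⟨a', ha'⟩)⟩
  · rintro B ⟨a, ha, hB⟩
    refine ⟨FinSum.single a, ⟨a, ha, Ideal.mem_principal_self⟩, ?_⟩
    rintro ⟨a', ha'⟩
    obtain rfl := Finset.mem_singleton.1 ha'
    exact hB

/-- The function `𝛀` with `𝛀 𝟎 = 𝟎` and `𝛀 v = ⊥` otherwise. -/
noncomputable def daimon : SumsFun L := lin (fun _ => ⊥) fun _ _ _ => le_rfl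

theorem daimon_of_ne {K : Sums L} (h : K ≠ ⊤) : (daimon : SumsFun L).toFun K = ⊥ := by
  refine le_bot_iff.1 ?_
  rintro B ⟨A, hA, hB⟩
  by_cases hne : A.terms.Nonempty
  · obtain ⟨a, ha⟩ := hne
    exact hB ⟨a, ha⟩
  · refine absurd (Ideal.top_of_top_mem (I := K) ?_) h
    have : A = ⊤ := by
      cases A
      exact congrArg FinSum.mk (Finset.not_nonempty_iff_eq_empty.1 hne)
    exact this ▸ hA

theorem daimon_le (f : SumsFun L) : daimon ≤ f := by
  intro K
  change daimon.toFun K ≤ f.toFun K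
  by_cases h : K = ⊤
  · rw [h, f.map_top]
    exact le_top
  · rw [daimon_of_ne h]
    exact bot_le

/-- A function is total if it sends total elements to total elements. -/
def Total (κ : Convention) (f : SumsFun L) : Prop := ∀ K, K.Total κ → (f.toFun K).Total κ

theorem conFin_mono (c : L.Con) (p : L.OddPrio) :
    Monotone fun a : FinTree L => (Ideal.principal (FinSum.single (.con c p a)) : Sums L) :=
  fun _ _ h => Ideal.principal_le_iff.2 (FinSum.single_mono (FinTree.con_mono c p h))

/-- `C`, on `𝒮`. -/
noncomputable def con (c : L.Con) (p : L.OddPrio) : SumsFun L :=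
  lin (fun a => Ideal.principal (FinSum.single (.con c p a))) (conFin_mono c p)

/-- The projection of a finite value on the field `d`: `⊥` on `⊥`, the field `d` of a record that
has such a field, and the error `𝟎` otherwise. -/
noncomputable def projFin (d : L.Des) : FinTree L → Sums L
  | .bot => ⊥
  | .str s _ t => open scoped Classical in
      if h : d ∈ s then Ideal.principal (FinSum.single (t ⟨d, h⟩)) else ⊤
  | _ => ⊤

theorem projFin_mono (d : L.Des) : Monotone (projFin d) := by
  intro t u h
  change FinTree.Le t u at h
  cases h with
  | bot t => exact bot_le
  | atom x => exact le_rfl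
  | con c' p' h => exact le_rfl
  | str s' p' h =>
    simp only [projFin]
    split_ifs
    · exact Ideal.principal_le_iff.2 (FinSum.single_mono (h _))
    · exact le_rfl

/-- The projection on the field `d`, on `𝒮`. -/
noncomputable def proj (d : L.Des) : SumsFun L := lin (projFin d) (projFin_mono d)

/-- The lifting of a typed function, on finite simple values. -/
noncomputable def hatFin {A B : L.Typ} (f : DenFun A B) (a : FinTree L) : Sums L :=
  open scoped Classical in
  if h : a.HasType A then Sums.simple (f.toFun (Den.fin a h)).1 else ⊤

theorem hatFin_mono {A B : L.Typ} (f : DenFun A B) : Monotone (hatFin f) := by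
  intro a a' h
  simp only [hatFin]
  by_cases h' : a'.HasType A
  · simp only [h', FinTree.HasType.lower h h', dite_true]
    rintro B ⟨b, hb, hB⟩
    exact ⟨b, f.cont.monotone (Den.fin_le.2 h : Den.fin a _ ≤ Den.fin a' h') hb, hB⟩
  · simp only [h', dite_false]
    exact le_top

/-- The lifting of a typed function: `f v` if `v ∈ ⟦A⟧`, and `𝟎` on the simple values that are not
in `⟦A⟧`. -/
noncomputable def hat {A B : L.Typ} (f : DenFun A B) : SumsFun L := lin (hatFin f) (hatFin_mono f)

/-- The lifting agrees with `f` on all typed values, finite or not. -/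
theorem hat_simple {A B : L.Typ} (f : DenFun A B) (v : Den A) :
    (hat f).toFun (Sums.simple v.1) = Sums.simple (f.toFun v).1 := by
  refine (lin_simple _ _ _).trans (le_antisymm ?_ ?_)
  · rintro C ⟨a, ha, hC⟩
    rw [hatFin, dif_pos (v.2 a ha)] at hC
    obtain ⟨b, hb, hC⟩ := hC
    exact ⟨b, f.cont.monotone (Den.fin_le.2 ha : Den.fin a (v.2 a ha) ≤ v) hb, hC⟩
  · rintro C ⟨b, hb, hC⟩
    obtain ⟨a, ha, h⟩ := Den.finitary f.cont v hb
    refine ⟨a, ha, ?_⟩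
    rw [hatFin, dif_pos (v.2 a ha)]
    exact ⟨b, h, hC⟩

/-- The lifting is the error on all simple values, finite or not, that are not in `⟦A⟧`. -/
theorem hat_simple_of_not {A B : L.Typ} (f : DenFun A B) (v : Val L)
    (hv : ¬ ∀ a ∈ v, a.HasType A) : (hat f).toFun (Sums.simple v) = ⊤ := by
  push Not at hv
  obtain ⟨a, ha, h⟩ := hv
  refine (lin_simple _ _ _).trans (top_le_iff.1 fun C _ => ⟨a, ha, ?_⟩)
  rw [hatFin, dif_neg h]
  trivial

end SumsFun

/-! ### Definitions -/

/-- Well-typed linear patterns. A pattern of a coinductive type has all the fields of the type.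
Variables are identified with the places where they appear, so that patterns are linear. -/
inductive Pat (L : Lang) : L.Typ → Type
  | var (τ : L.Typ) : Pat L τ
  | con (T : L.Data) (args : Fin (L.dArity T) → L.Typ) (c : L.Ctor T)
      (p : Pat L (L.argTy T args c)) : Pat L (.data T args)
  | str (T : L.Codata) (args : Fin (L.cArity T) → L.Typ)
      (ps : ∀ d : L.Field T, Pat L (L.resTy T args d)) : Pat L (.codata T args)

namespace Pat

/-- The variables of a pattern. -/
def Var {τ : L.Typ} : Pat L τ → Type
  | .var _ => Unit
  | .con _ _ _ p => p.Var
  | .str _ _ ps => Σ d, (ps d).Var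

/-- The types of the variables of a pattern. -/
def varTy {τ : L.Typ} : (p : Pat L τ) → p.Var → L.Typ
  | .var τ, _ => τ
  | .con _ _ _ p, x => p.varTy x
  | .str _ _ ps, x => (ps x.1).varTy x.2

/-- The finite value `a` is defined enough to see that it matches the pattern. -/
def MatchesFin {τ : L.Typ} : Pat L τ → FinTree L → Prop
  | .var _, _ => True
  | .con T args c p, a => ∃ t, a = .con ⟨T, c⟩ (L.dataPrio T args) t ∧ p.MatchesFin t
  | .str T args ps, a => ∃ t, a = .str (L.fields T) (L.codataPrio T args) t ∧
      ∀ d, (ps d).MatchesFin (t (L.field T d))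

/-- The finite value `a` is defined enough to see that it does not match the pattern: an atom, a
constructor or a record is met where the pattern has something different. -/
def FailsFin {τ : L.Typ} : Pat L τ → FinTree L → Prop
  | .var _, _ => False
  | .con T args c p, a => a ≠ .bot ∧
      ∀ t, a = .con ⟨T, c⟩ (L.dataPrio T args) t → p.FailsFin t
  | .str T args ps, a => a ≠ .bot ∧
      ∀ t, a = .str (L.fields T) (L.codataPrio T args) t →
        ∃ d, (ps d).FailsFin (t (L.field T d))

theorem MatchesFin.upper {τ : L.Typ} (p : Pat L τ) :
    ∀ {a a' : FinTree L}, FinTree.Le a a' → p.MatchesFin a → p.MatchesFin a' := by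
  induction p with
  | var τ => intros; trivial
  | con T args c p ih =>
    rintro _ a' h ⟨t, rfl, ht⟩
    cases h with | con _ _ h => exact ⟨_, rfl, ih h ht⟩
  | str T args ps ih =>
    rintro _ a' h ⟨t, rfl, ht⟩
    cases h with | str _ _ h => exact ⟨_, rfl, fun d => ih d (h _) (ht d)⟩

theorem FailsFin.upper {τ : L.Typ} (p : Pat L τ) :
    ∀ {a a' : FinTree L}, FinTree.Le a a' → p.FailsFin a → p.FailsFin a' := by
  induction p with
  | var τ => intro a a' _ h; exact h
  | con T args c p ih =>
    rintro a a' h ⟨h1, h2⟩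
    refine ⟨?_, ?_⟩
    · rintro rfl
      exact h1 (FinTree.eq_bot_of_le_bot h)
    · rintro t rfl
      cases h with
      | bot => exact absurd rfl h1
      | con _ _ h => exact ih h (h2 _ rfl)
  | str T args ps ih =>
    rintro a a' h ⟨h1, h2⟩
    refine ⟨?_, ?_⟩
    · rintro rfl
      exact h1 (FinTree.eq_bot_of_le_bot h)
    · rintro t rfl
      cases h with
      | bot => exact absurd rfl h1
      | str _ _ h =>
        obtain ⟨d, hd⟩ := h2 _ rfl
        exact ⟨d, ih d (h _) hd⟩

/-- The value `v` matches the pattern. -/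
def Matches {τ : L.Typ} (p : Pat L τ) (v : Val L) : Prop := ∃ a ∈ v, p.MatchesFin a

/-- The value `v` is refused by the pattern. A value that is neither refused nor matched is not
defined enough (`⊥` is met where the pattern has a constructor or a record). -/
def Fails {τ : L.Typ} (p : Pat L τ) (v : Val L) : Prop := ∃ a ∈ v, p.FailsFin a

theorem not_matchesFin_of_failsFin {τ : L.Typ} (p : Pat L τ) :
    ∀ {a : FinTree L}, p.FailsFin a → ¬ p.MatchesFin a := by
  induction p with
  | var τ => intro a h; exact absurd h id
  | con T args c p ih =>
    rintro _ ⟨-, h⟩ ⟨t, rfl, ht⟩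
    exact ih (h t rfl) ht
  | str T args ps ih =>
    rintro _ ⟨-, h⟩ ⟨t, rfl, ht⟩
    obtain ⟨d, hd⟩ := h t rfl
    exact ih d hd (ht d)

theorem not_matches_of_fails {τ : L.Typ} {p : Pat L τ} {v : Val L} (h : p.Fails v) :
    ¬ p.Matches v := by
  rintro ⟨a, ha, hm⟩
  obtain ⟨b, hb, hf⟩ := h
  obtain ⟨e, -, h1, h2⟩ := v.directed a ha b hb
  exact p.not_matchesFin_of_failsFin (FailsFin.upper p h2 hf) (MatchesFin.upper p h1 hm)

/-- The substitution `[p := v]`, for a value `v` that matches the pattern `p`. -/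
noncomputable def unifier {τ : L.Typ} : (p : Pat L τ) → Val L → p.Var → Val L
  | .var _, v, _ => v
  | .con T args c p, v, x => p.unifier (v.unCon ⟨T, c⟩ (L.dataPrio T args)) x
  | .str T args ps, v, x =>
      (ps x.1).unifier (v.unStr (L.fields T) (L.codataPrio T args) (L.field T x.1)) x.2

/-- The substitution `[p := v]`, on typed values. -/
noncomputable def unifierDen {τ : L.Typ} : (p : Pat L τ) → Den τ → (x : p.Var) → Den (p.varTy x)
  | .var _, v, _ => v
  | .con T args c p, v, x => p.unifierDen (v.unCon T args c) x
  | .str T args ps, v, x => (ps x.1).unifierDen (v.proj T args x.1) x.2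

end Pat

/-- Well-typed right-hand sides of clauses for a function of type `A → B`, with variables in `Γ`:
variables, constructors, records, projections, calls to other functions, recursive calls. -/
inductive Tm (L : Lang) (A B : L.Typ) {X : Type} (Γ : X → L.Typ) : L.Typ → Type
  | var (x : X) : Tm L A B Γ (Γ x)
  | con (T : L.Data) (args : Fin (L.dArity T) → L.Typ) (c : L.Ctor T)
      (u : Tm L A B Γ (L.argTy T args c)) : Tm L A B Γ (.data T args)
  | str (T : L.Codata) (args : Fin (L.cArity T) → L.Typ)
      (u : ∀ d : L.Field T, Tm L A B Γ (L.resTy T args d)) : Tm L A B Γ (.codata T args)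
  | proj (T : L.Codata) (args : Fin (L.cArity T) → L.Typ) (d : L.Field T)
      (u : Tm L A B Γ (.codata T args)) : Tm L A B Γ (L.resTy T args d)
  | call (g : L.Fn) (u : Tm L A B Γ (L.dom g)) : Tm L A B Γ (L.cod g)
  | self (u : Tm L A B Γ A) : Tm L A B Γ B

namespace Tm

variable {A B : L.Typ} {X : Type} {Γ : X → L.Typ}

/-- Typed semantics, in the interpretation of types. -/
noncomputable def den (ρ : ∀ g, DenFun (L.dom g) (L.cod g)) (f : DenFun A B)
    (s : ∀ x, Den (Γ x)) {τ : L.Typ} : Tm L A B Γ τ → Den τ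
  | .var x => s x
  | .con T args c u => .con T args c (u.den ρ f s)
  | .str T args u => .str T args fun d => (u d).den ρ f s
  | .proj T args d u => .proj T args d (u.den ρ f s)
  | .call g u => (ρ g).toFun (u.den ρ f s)
  | .self u => f.toFun (u.den ρ f s)

/-- Untyped semantics, in `𝒮`. -/
noncomputable def sem (σ : L.Fn → SumsFun L) (f : SumsFun L) (s : X → Sums L) {τ : L.Typ} :
    Tm L A B Γ τ → Sums L
  | .var x => s x
  | .con T args c u => (SumsFun.con ⟨T, c⟩ (L.dataPrio T args)).toFun (u.sem σ f s)
  | .str T args u => Sums.str (L.fields T) (L.codataPrio T args)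
      fun d => (u (d.2 ▸ d.1.2)).sem σ f s
  | .proj T _ d u => (SumsFun.proj ⟨T, d⟩).toFun (u.sem σ f s)
  | .call g u => (σ g).toFun (u.sem σ f s)
  | .self u => f.toFun (u.sem σ f s)

end Tm

/-! ### Continuity of the constructions -/

section Continuity

theorem Den.con_cont (T : L.Data) (args : Fin (L.dArity T) → L.Typ) (c : L.Ctor T) :
    ScottContinuous (Den.con T args c) :=
  Den.scottContinuous_of_finitary
    (by
      rintro v w h b ⟨a, ha, hb⟩
      exact ⟨a, h ha, hb⟩)
    (by
      rintro v b ⟨a, ha, hb⟩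
      exact ⟨a, ha, a, Ideal.mem_principal_self, hb⟩)

theorem Den.unCon_cont (T : L.Data) (args : Fin (L.dArity T) → L.Typ) (c : L.Ctor T) :
    ScottContinuous (Den.unCon T args c) :=
  Den.scottContinuous_of_finitary
    (by
      rintro v w h b ⟨a, ha, hb⟩
      exact ⟨a, h ha, hb⟩)
    (by
      rintro v b ⟨a, ha, hb⟩
      exact ⟨a, ha, a, Ideal.mem_principal_self, hb⟩)

theorem Den.proj_cont (T : L.Codata) (args : Fin (L.cArity T) → L.Typ) (d : L.Field T) :
    ScottContinuous (Den.proj T args d) :=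
  Den.scottContinuous_of_finitary
    (by
      rintro v w h b ⟨a, ha, hb⟩
      exact ⟨a, h ha, hb⟩)
    (by
      rintro v b ⟨a, ha, hb⟩
      exact ⟨a, ha, a, Ideal.mem_principal_self, hb⟩)

theorem exists_upper_bound {P ι : Type} [Preorder P] [Finite ι] (I : Ideal P) (a : ι → P)
    (ha : ∀ i, a i ∈ I) : ∃ e ∈ I, ∀ i, a i ≤ e := by
  classical
  let _ := Fintype.ofFinite ι
  have h : ∀ s : Finset ι, ∃ e ∈ I, ∀ i ∈ s, a i ≤ e := by
    intro s
    induction s using Finset.induction_on with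
    | empty =>
      obtain ⟨e, he⟩ := I.nonempty
      exact ⟨e, he, by simp⟩
    | insert i s _ ih =>
      obtain ⟨e, he, h⟩ := ih
      obtain ⟨e', he', h1, h2⟩ := I.directed e he (a i) (ha i)
      refine ⟨e', he', fun j hj => ?_⟩
      rcases Finset.mem_insert.1 hj with rfl | hj
      · exact h2
      · exact (h j hj).trans h1
  obtain ⟨e, he, h⟩ := h Finset.univ
  exact ⟨e, he, fun i => h i (Finset.mem_univ i)⟩

theorem Den.str_mono (T : L.Codata) (args : Fin (L.cArity T) → L.Typ) :
    Monotone (Den.str T args) := by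
  rintro v w h b ⟨a, ha, hb⟩
  exact ⟨a, fun d => h _ (ha d), hb⟩

theorem Den.str_cont {τ : L.Typ} (T : L.Codata) (args : Fin (L.cArity T) → L.Typ)
    {f : ∀ d : L.Field T, Den τ → Den (L.resTy T args d)} (hf : ∀ d, ScottContinuous (f d)) :
    ScottContinuous fun v => Den.str T args fun d => f d v := by
  refine Den.scottContinuous_of_finitary
    (fun v w h => Den.str_mono T args fun d => (hf d).monotone h) ?_
  rintro v b ⟨a, ha, hb⟩
  choose e he h using fun d : L.fields T => Den.finitary (hf (d.2 ▸ d.1.2)) v (ha d)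
  obtain ⟨m, hm, hem⟩ := exists_upper_bound v.1 e he
  exact ⟨m, hm, a, fun d => (hf _).monotone (Den.fin_le.2 (hem d)) (h d), hb⟩

theorem Pat.unifierDen_cont {τ : L.Typ} (p : Pat L τ) :
    ∀ x, ScottContinuous fun v => p.unifierDen v x := by
  induction p with
  | var τ => exact fun _ => ScottContinuous.id
  | con T args c p ih => exact fun x => (Den.unCon_cont T args c).comp (ih x)
  | str T args ps ih => exact fun x => (Den.proj_cont T args x.1).comp (ih x.1 x.2)

variable {A B : L.Typ} {X : Type} {Γ : X → L.Typ}

theorem Tm.den_cont (ρ : ∀ g, DenFun (L.dom g) (L.cod g)) (f : DenFun A B) {τ₀ : L.Typ}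
    {s : ∀ x, Den τ₀ → Den (Γ x)} (hs : ∀ x, ScottContinuous (s x)) {τ : L.Typ}
    (u : Tm L A B Γ τ) : ScottContinuous fun v => u.den ρ f fun x => s x v := by
  induction u with
  | var x => exact hs x
  | con T args c u ih => exact ih.comp (Den.con_cont T args c)
  | str T args u ih => exact Den.str_cont T args ih
  | proj T args d u ih => exact ih.comp (Den.proj_cont T args d)
  | call g u ih => exact ih.comp (ρ g).cont
  | self u ih => exact ih.comp f.cont

theorem Tm.den_mono (ρ : ∀ g, DenFun (L.dom g) (L.cod g)) {f f' : DenFun A B} (hf : f ≤ f')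
    (s : ∀ x, Den (Γ x)) {τ : L.Typ} (u : Tm L A B Γ τ) : u.den ρ f s ≤ u.den ρ f' s := by
  induction u with
  | var x => exact le_rfl
  | con T args c u ih => exact (Den.con_cont T args c).monotone ih
  | str T args u ih => exact Den.str_mono T args ih
  | proj T args d u ih => exact (Den.proj_cont T args d).monotone ih
  | call g u ih => exact (ρ g).cont.monotone ih
  | self u ih => exact (f.cont.monotone ih).trans (hf _)

theorem Sums.str_cont {P : Type} [Preorder P] (s : Set L.Des) (p : L.EvenPrio)
    {f : s → Ideal P → Sums L} (hm : ∀ d, Monotone (f d))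
    (hf : ∀ d I, ∀ b ∈ f d I, ∃ a ∈ I, b ∈ f d (Ideal.principal a)) :
    ∀ I, ∀ b ∈ Sums.str s p (fun d => f d I),
      ∃ a ∈ I, b ∈ Sums.str s p (fun d => f d (Ideal.principal a)) := by
  rintro I b ⟨A, hA, hb⟩
  choose e he h using fun d => hf d I (A d) (hA d)
  obtain ⟨m, hm', hem⟩ := exists_upper_bound I e he
  exact ⟨m, hm', A, fun d => hm d (Ideal.principal_le_iff.2 (hem d)) (h d), hb⟩

theorem Tm.sem_mono (σ : L.Fn → SumsFun L) {f f' : SumsFun L} (hf : f ≤ f')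
    {s s' : X → Sums L} (hs : ∀ x, s x ≤ s' x) {τ : L.Typ} (u : Tm L A B Γ τ) :
    u.sem σ f s ≤ u.sem σ f' s' := by
  induction u with
  | var x => exact hs x
  | con T args c u ih => exact (SumsFun.con _ _).cont.monotone ih
  | str T args u ih => exact Sums.str_le _ _ fun d => ih _
  | proj T args d u ih => exact (SumsFun.proj _).cont.monotone ih
  | call g u ih => exact (σ g).cont.monotone ih
  | self u ih => exact (f.cont.monotone ih).trans (hf _)

theorem SumsFun.comp_finitary {P : Type} [Preorder P] (f : SumsFun L) {g : Ideal P → Sums L}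
    (hg : ∀ I, ∀ b ∈ g I, ∃ a ∈ I, b ∈ g (Ideal.principal a)) :
    ∀ I, ∀ b ∈ f.toFun (g I), ∃ a ∈ I, b ∈ f.toFun (g (Ideal.principal a)) := by
  intro I b hb
  obtain ⟨C, hC, hb⟩ := f.finitary _ hb
  obtain ⟨a, ha, h⟩ := hg I C hC
  exact ⟨a, ha, f.cont.monotone (Ideal.principal_le_iff.2 h) hb⟩

theorem Tm.sem_finitary {P : Type} [Preorder P] (σ : L.Fn → SumsFun L) (f : SumsFun L)
    {s : X → Ideal P → Sums L} (hm : ∀ x, Monotone (s x))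
    (hs : ∀ x I, ∀ b ∈ s x I, ∃ a ∈ I, b ∈ s x (Ideal.principal a)) {τ : L.Typ}
    (u : Tm L A B Γ τ) :
    ∀ I, ∀ b ∈ u.sem σ f (fun x => s x I),
      ∃ a ∈ I, b ∈ u.sem σ f (fun x => s x (Ideal.principal a)) := by
  have mono : ∀ {τ : L.Typ} (u : Tm L A B Γ τ), Monotone fun I => u.sem σ f (fun x => s x I) :=
    fun u _ _ h => u.sem_mono σ le_rfl fun x => hm x h
  induction u with
  | var x => exact hs x
  | con T args c u ih => exact SumsFun.comp_finitary _ ih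
  | str T args u ih =>
    exact Sums.str_cont (L.fields T) (L.codataPrio T args)
      (f := fun d I => (u (d.2 ▸ d.1.2)).sem σ f (fun x => s x I))
      (fun d => mono _) (fun d => ih _)
  | proj T args d u ih => exact SumsFun.comp_finitary _ ih
  | call g u ih => exact SumsFun.comp_finitary _ ih
  | self u ih => exact SumsFun.comp_finitary _ ih

theorem Pat.unifier_mono {τ : L.Typ} (p : Pat L τ) :
    ∀ x, Monotone fun v => p.unifier v x := by
  induction p with
  | var τ => exact fun _ => monotone_id
  | con T args c p ih =>
    intro x v w h
    refine ih x ?_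
    rintro b ⟨a, ha, hb⟩
    exact ⟨a, h ha, hb⟩
  | str T args ps ih =>
    intro x v w h
    refine ih x.1 x.2 ?_
    rintro b ⟨a, ha, hb⟩
    exact ⟨a, h ha, hb⟩

theorem Pat.unifier_finitary {τ : L.Typ} (p : Pat L τ) :
    ∀ x v, ∀ b ∈ p.unifier v x, ∃ a ∈ v, b ∈ p.unifier (Ideal.principal a) x := by
  induction p with
  | var τ => exact fun _ v b hb => ⟨b, hb, Ideal.mem_principal_self⟩
  | con T args c p ih =>
    intro x v b hb
    obtain ⟨e, ⟨a, ha, hea⟩, h⟩ := ih x _ b hb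
    have he : e ∈ Val.unCon ⟨T, c⟩ (L.dataPrio T args) (Ideal.principal a) :=
      ⟨a, Ideal.mem_principal_self, hea⟩
    exact ⟨a, ha, p.unifier_mono x (Ideal.principal_le_iff.2 he) h⟩
  | str T args ps ih =>
    intro x v b hb
    obtain ⟨e, ⟨a, ha, hea⟩, h⟩ := ih x.1 x.2 _ b hb
    have he : e ∈ Val.unStr (L.fields T) (L.codataPrio T args) (L.field T x.1)
        (Ideal.principal a) := ⟨a, Ideal.mem_principal_self, hea⟩
    exact ⟨a, ha, (ps x.1).unifier_mono x.2 (Ideal.principal_le_iff.2 he) h⟩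

end Continuity

/-! ### The two semantics of a definition -/

/-- A clause `f p = u` for a function of type `A → B`. -/
structure Clause (L : Lang) (A B : L.Typ) where
  pat : Pat L A
  rhs : Tm L A B pat.varTy B

/-- An ordered list of clauses of type `A → B`. -/
abbrev Clauses (L : Lang) (A B : L.Typ) : Type := List (Clause L A B)

variable {A B : L.Typ}

/-- The clauses are exhaustive: no value in `⟦A⟧` is refused by all of them. -/
def Clauses.Exhaustive (cs : Clauses L A B) : Prop :=
  ∀ v : Den A, ∃ c ∈ cs, ¬ c.pat.Fails v.1

/-- The value at `v` of the standard semantics: the first clause that `v` matches is used. When `v`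
is not defined enough to tell which clause this is, the result is undefined. -/
noncomputable def Clauses.firstMatch (ρ : ∀ g, DenFun (L.dom g) (L.cod g)) (f : DenFun A B)
    (v : Den A) : Clauses L A B → Den B
  | [] => ⊥
  | c :: cs => open scoped Classical in
      if c.pat.Fails v.1 then Clauses.firstMatch ρ f v cs
      else if c.pat.Matches v.1 then c.rhs.den ρ f (c.pat.unifierDen v)
      else ⊥

theorem Clauses.firstMatch_mono (ρ : ∀ g, DenFun (L.dom g) (L.cod g)) {f f' : DenFun A B}
    (hf : f ≤ f') {v v' : Den A} (hv : v ≤ v') (cs : Clauses L A B) :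
    Clauses.firstMatch ρ f v cs ≤ Clauses.firstMatch ρ f' v' cs := by
  induction cs with
  | nil => exact le_rfl
  | cons c cs ih =>
    simp only [firstMatch]
    by_cases h1 : c.pat.Fails v.1
    · obtain ⟨a, ha, h⟩ := h1
      rw [if_pos ⟨a, ha, h⟩, if_pos ⟨a, hv ha, h⟩]
      exact ih
    · rw [if_neg h1]
      by_cases h2 : c.pat.Matches v.1
      · obtain ⟨a, ha, h⟩ := h2
        have h2' : c.pat.Matches v'.1 := ⟨a, hv ha, h⟩
        rw [if_pos ⟨a, ha, h⟩, if_neg fun h => Pat.not_matches_of_fails h h2', if_pos h2']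
        exact (c.rhs.den_mono ρ hf _).trans
          ((c.rhs.den_cont ρ f' c.pat.unifierDen_cont).monotone hv)
      · rw [if_neg h2]
        exact bot_le

theorem Clauses.firstMatch_cont (ρ : ∀ g, DenFun (L.dom g) (L.cod g)) (f : DenFun A B)
    (cs : Clauses L A B) : ScottContinuous fun v => Clauses.firstMatch ρ f v cs := by
  refine Den.scottContinuous_of_finitary
    (fun v w h => Clauses.firstMatch_mono ρ le_rfl h cs) ?_
  induction cs with
  | nil => exact fun v b hb => ⟨⊥, Ideal.bot_mem v.1, hb⟩
  | cons c cs ih =>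
    intro v b hb
    simp only [firstMatch] at hb ⊢
    by_cases h1 : c.pat.Fails v.1
    · rw [if_pos h1] at hb
      obtain ⟨a, ha, h⟩ := h1
      obtain ⟨a', ha', hb⟩ := ih v b hb
      obtain ⟨e, he, h1, h2⟩ := v.1.directed a ha a' ha'
      refine ⟨e, he, ?_⟩
      rw [if_pos ⟨a, h1, h⟩]
      exact Clauses.firstMatch_mono ρ le_rfl (Den.fin_le.2 h2) cs hb
    · rw [if_neg h1] at hb
      by_cases h2 : c.pat.Matches v.1
      · rw [if_pos h2] at hb
        obtain ⟨a, ha, h⟩ := h2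
        have hc := c.rhs.den_cont ρ f c.pat.unifierDen_cont
        obtain ⟨a', ha', hb⟩ := Den.finitary hc v hb
        obtain ⟨e, he, h3, h4⟩ := v.1.directed a ha a' ha'
        have hm : c.pat.Matches (Den.fin e (v.2 e he)).1 := ⟨a, h3, h⟩
        refine ⟨e, he, ?_⟩
        rw [if_neg fun h => Pat.not_matches_of_fails h hm, if_pos hm]
        exact hc.monotone (Den.fin_le.2 h4 : Den.fin a' _ ≤ Den.fin e (v.2 e he)) hb
      · rw [if_neg h2] at hb
        exact ⟨⊥, Ideal.bot_mem v.1, (bot_le : (⊥ : Den B) ≤ _) hb⟩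

/-- The operator of the standard semantics, where `ρ` interprets the other functions. -/
noncomputable def Clauses.std (cs : Clauses L A B) (ρ : ∀ g, DenFun (L.dom g) (L.cod g)) :
    DenFun A B →o DenFun A B where
  toFun f := ⟨fun v => Clauses.firstMatch ρ f v cs, Clauses.firstMatch_cont ρ f cs⟩
  monotone' _ _ h := fun _ => Clauses.firstMatch_mono ρ h le_rfl cs

/-- The value of a single clause at a simple value `v`: the error `𝟎` if `v` is refused by the
pattern, `⟦u[p := v]⟧` if it matches, and `⊥` if it is not defined enough. -/
noncomputable def Clause.sem (σ : L.Fn → SumsFun L) (f : SumsFun L) (v : Val L)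
    (c : Clause L A B) : Sums L :=
  open scoped Classical in
  if c.pat.Fails v then ⊤
  else if c.pat.Matches v then c.rhs.sem σ f fun x => Sums.simple (c.pat.unifier v x)
  else ⊥

theorem Sums.simple_mono : Monotone (Sums.simple : Val L → Sums L) := by
  rintro v w h B ⟨a, ha, hB⟩
  exact ⟨a, h ha, hB⟩

theorem Clause.sem_mono (σ : L.Fn → SumsFun L) {f f' : SumsFun L} (hf : f ≤ f') {v v' : Val L}
    (hv : v ≤ v') (c : Clause L A B) : c.sem σ f v ≤ c.sem σ f' v' := by
  simp only [sem]
  by_cases h1 : c.pat.Fails v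
  · obtain ⟨a, ha, h⟩ := h1
    rw [if_pos ⟨a, ha, h⟩, if_pos ⟨a, hv ha, h⟩]
  · rw [if_neg h1]
    by_cases h1' : c.pat.Fails v'
    · rw [if_pos h1']
      exact le_top
    · rw [if_neg h1']
      by_cases h2 : c.pat.Matches v
      · obtain ⟨a, ha, h⟩ := h2
        rw [if_pos ⟨a, ha, h⟩, if_pos ⟨a, hv ha, h⟩]
        exact c.rhs.sem_mono σ hf fun x => Sums.simple_mono (c.pat.unifier_mono x hv)
      · rw [if_neg h2]
        exact bot_le

/-- The sum of all the clauses, at a simple value. -/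
noncomputable def Clauses.sumAll (σ : L.Fn → SumsFun L) (f : SumsFun L) (cs : Clauses L A B)
    (v : Val L) : Sums L :=
  Sums.sum fun i : Fin cs.length => (cs.get i).sem σ f v

theorem Clauses.sumAll_mono (σ : L.Fn → SumsFun L) (f : SumsFun L) (cs : Clauses L A B) :
    Monotone fun a : FinTree L => cs.sumAll σ f (Ideal.principal a) :=
  fun _ _ h => Sums.sum_mono fun _ =>
    Clause.sem_mono σ le_rfl (Ideal.principal_le_iff.2 h) _

/-- The operator of the non-deterministic semantics, where `σ` interprets the other functions:
linear on sums, and the sum of all the clauses on simple values. -/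
noncomputable def Clauses.ndt (cs : Clauses L A B) (σ : L.Fn → SumsFun L) :
    SumsFun L →o SumsFun L where
  toFun f := SumsFun.lin (fun a => cs.sumAll σ f (Ideal.principal a)) (cs.sumAll_mono σ f)
  monotone' _ _ h := SumsFun.lin_mono fun _ => Sums.sum_mono fun _ => Clause.sem_mono σ h le_rfl _

/-- The defining formula of the non-deterministic semantics holds for all simple values, finite or
not. -/
theorem Clauses.ndt_simple (cs : Clauses L A B) (σ : L.Fn → SumsFun L) (f : SumsFun L)
    (v : Val L) : (cs.ndt σ f).toFun (Sums.simple v) = cs.sumAll σ f v := by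
  have hm : ∀ {v w : Val L}, v ≤ w → cs.sumAll σ f v ≤ cs.sumAll σ f w :=
    fun h => Sums.sum_mono fun _ => Clause.sem_mono σ le_rfl h _
  have hc : ∀ c : Clause L A B, ∀ b ∈ c.sem σ f v, ∃ a ∈ v, b ∈ c.sem σ f (Ideal.principal a) := by
    intro c b hb
    by_cases h1 : c.pat.Fails v
    · obtain ⟨a, ha, h⟩ := h1
      refine ⟨a, ha, ?_⟩
      rw [Clause.sem, if_pos ⟨a, Ideal.mem_principal_self, h⟩]
      trivial
    · by_cases h2 : c.pat.Matches v
      · rw [Clause.sem, if_neg h1, if_pos h2] at hb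
        obtain ⟨a, ha, h⟩ := h2
        obtain ⟨a', ha', hb⟩ := Tm.sem_finitary σ f
          (s := fun x v => Sums.simple (c.pat.unifier v x))
          (fun x _ _ h => Sums.simple_mono (c.pat.unifier_mono x h))
          (by
            rintro x I B ⟨e, he, hB⟩
            obtain ⟨a, ha, h⟩ := c.pat.unifier_finitary x I e he
            exact ⟨a, ha, e, h, hB⟩) c.rhs v b hb
        obtain ⟨e, he, h3, h4⟩ := v.directed a ha a' ha'
        refine ⟨e, he, ?_⟩
        have hme : c.pat.Matches (Ideal.principal e) := ⟨a, h3, h⟩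
        rw [Clause.sem, if_neg fun h => Pat.not_matches_of_fails h hme, if_pos hme]
        exact c.rhs.sem_mono σ le_rfl (fun x => Sums.simple_mono
          (c.pat.unifier_mono x (Ideal.principal_le_iff.2 h4))) hb
      · rw [Clause.sem, if_neg h1, if_neg h2] at hb
        exact ⟨⊥, Ideal.bot_mem v, (bot_le : ⊥ ≤ c.sem σ f _) hb⟩
  refine (SumsFun.lin_simple _ (cs.sumAll_mono σ f) v).trans (le_antisymm ?_ ?_)
  · rintro B ⟨a, ha, hB⟩
    exact hm (Ideal.principal_le_iff.2 ha) hB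
  · intro B hB
    choose a ha h using fun i => hc (cs.get i) B (hB i)
    obtain ⟨e, he, hae⟩ := exists_upper_bound v a ha
    exact ⟨e, he, fun i => Clause.sem_mono σ le_rfl (Ideal.principal_le_iff.2 (hae i)) _ (h i)⟩

/-- Kleene's formula `⨆ₙ φⁿ(⊥)`: the standard semantics of a definition. -/
noncomputable def Clauses.fixStd (cs : Clauses L A B) (ρ : ∀ g, DenFun (L.dom g) (L.cod g)) :
    DenFun A B :=
  ωSup (fixedPoints.iterateChain (cs.std ρ) ⊥ bot_le)

/-- Kleene's formula `⨆ₙ φⁿ(𝛀)`: the non-deterministic semantics of a definition. -/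
noncomputable def Clauses.fixNdt (cs : Clauses L A B) (σ : L.Fn → SumsFun L) : SumsFun L :=
  ωSup (fixedPoints.iterateChain (cs.ndt σ) SumsFun.daimon (SumsFun.daimon_le _))

end Chariot

/-! The non-deterministic fixed point lies below the lifting of the standard one, in the pointwise
order of `SumsFun` (`Clauses.fixNdt_le_hat_fixStd`). In the Smyth order a sum is a greatest lower
bound, so adding summands only moves an element down. At a typed value the standard operator
evaluates a single clause, and the non-deterministic operator has that clause among its summands;
hence one step of the latter on `hat f` is below the lifting of one step of the former on `f`
(`Clauses.ndt_hat_le`). Monotonicity carries this along the iterates, which start from the least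
element `daimon`.

Two facts keep the error `𝟎`, which is the greatest element, from breaking the inequality. Typing
prevents the projections in a right-hand side from producing errors at typed arguments
(`SumsFun.proj_simple`, `Tm.sem_le_den`). Exhaustiveness guarantees a clause that does not refuse
the argument; otherwise the sum would be `𝟎` while the standard value is `⊥`.

Totality is then transferred as follows. Let `v` be a total value of type `A`. Total values are
maximal (`Val.Total.eq_of_le`), so `v` is the only simple value above `Sums.simple v`, which is
therefore total in `𝒮`. Its image under the non-deterministic fixed point is total and lies below
the simple value given by the standard fixed point at `v`. That value is thus a summand in the sense
of `Sums.Summand`, hence total. -/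

namespace Chariot

variable {L : Lang}

/-! ### Total values are maximal -/

/-! ### Inversion of the contextual order on finite values. -/

namespace FinTree

/-- Exposes the inductive relation behind `≤`, so that `cases` applies to it. -/
theorem le_iff_Le {t u : FinTree L} : t ≤ u ↔ Le t u := Iff.rfl

/-- This and the next lemmas serve to compare roots inside an ideal. Two approximations of a value
have a common upper bound; the root of the first, unless it is `⊥`, is the root of that bound, and
so of the second one unless it is `⊥`. -/
theorem con_le_iff {c : L.Con} {p : L.OddPrio} {t e : FinTree L} :
    FinTree.con c p t ≤ e ↔ ∃ u, e = .con c p u ∧ t ≤ u := by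
  refine ⟨fun h => ?_, ?_⟩
  · rw [le_iff_Le] at h
    cases h with | con _ _ h => exact ⟨_, rfl, h⟩
  · rintro ⟨u, rfl, h⟩
    exact con_mono c p h

theorem str_le_iff {s : Set L.Des} {p : L.EvenPrio} {t : s → FinTree L} {e : FinTree L} :
    FinTree.str s p t ≤ e ↔ ∃ u, e = .str s p u ∧ ∀ d, t d ≤ u d := by
  refine ⟨fun h => ?_, ?_⟩
  · rw [le_iff_Le] at h
    cases h with | str _ _ h => exact ⟨_, rfl, h⟩
  · rintro ⟨u, rfl, h⟩
    exact str_mono s p h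

theorem atom_le_iff {x : L.Atom} {e : FinTree L} : FinTree.atom x ≤ e ↔ e = .atom x := by
  refine ⟨fun h => ?_, ?_⟩
  · rw [le_iff_Le] at h
    cases h with | atom _ => rfl
  · rintro rfl
    exact le_rfl

theorem le_atom {x : L.Atom} {t : FinTree L} (h : t ≤ .atom x) (ht : t ≠ .bot) :
    t = .atom x := by
  rw [le_iff_Le] at h
  cases h with
  | bot => exact absurd rfl ht
  | atom _ => rfl

theorem le_con {c : L.Con} {p : L.OddPrio} {t e : FinTree L} (h : t ≤ .con c p e)
    (ht : t ≠ .bot) : ∃ u, t = .con c p u := by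
  rw [le_iff_Le] at h
  cases h with
  | bot => exact absurd rfl ht
  | con _ _ _ => exact ⟨_, rfl⟩

theorem le_str {s : Set L.Des} {p : L.EvenPrio} {e : s → FinTree L} {t : FinTree L}
    (h : t ≤ .str s p e) (ht : t ≠ .bot) : ∃ u, t = .str s p u := by
  rw [le_iff_Le] at h
  cases h with
  | bot => exact absurd rfl ht
  | str _ _ _ => exact ⟨_, rfl⟩

end FinTree

/-! ### Components of a value, and maximality of values without `⊥`. -/

namespace Val

/-- The hypothesis `hu` says that `v` starts with this constructor. Without it the equivalence fails
at `t = ⊥`, which always belongs to `v.unCon c p`. -/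
theorem mem_unCon {c : L.Con} {p : L.OddPrio} {v : Val L} {u t : FinTree L}
    (hu : FinTree.con c p u ∈ v) : t ∈ v.unCon c p ↔ FinTree.con c p t ∈ v := by
  refine ⟨?_, fun h => ⟨_, h, by simp [FinTree.unCon]⟩⟩
  rintro ⟨b, hb, htb⟩
  obtain ⟨e, he, h1, h2⟩ := v.directed _ hu b hb
  obtain ⟨e, rfl, -⟩ := FinTree.con_le_iff.1 h1
  have h := (Ideal.mem_principal.1 htb).trans (FinTree.unCon_mono c p h2)
  simp only [FinTree.unCon, and_self, if_true] at h
  exact v.lower (FinTree.con_mono c p h) he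

theorem mem_unStr {s : Set L.Des} {p : L.EvenPrio} {v : Val L} {u : s → FinTree L} {d : s}
    {t : FinTree L} (hu : FinTree.str s p u ∈ v) :
    t ∈ v.unStr s p d ↔ ∃ f, FinTree.str s p f ∈ v ∧ f d = t := by
  classical
  refine ⟨?_, ?_⟩
  · rintro ⟨b, hb, htb⟩
    obtain ⟨e, he, h1, h2⟩ := v.directed _ hu b hb
    obtain ⟨e, rfl, -⟩ := FinTree.str_le_iff.1 h1
    have h := (Ideal.mem_principal.1 htb).trans (FinTree.unStr_mono s p d h2)
    simp only [FinTree.unStr, and_self, dite_true] at h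
    -- The field `d` must be exactly `t`, which is only known to be at most `e d`. Lowering that one
    -- field of `e` stays inside the ideal.
    refine ⟨Function.update e d t, v.lower (FinTree.str_mono s p fun d' => ?_) he, by simp⟩
    by_cases hd : d' = d
    · subst hd
      simpa using h
    · simp [hd]
  · rintro ⟨f, hf, rfl⟩
    exact ⟨_, hf, by simp [FinTree.unStr]⟩

/-- Every position of the value carries an atom, a constructor or a record. -/
def BotFree (v : Val L) : Prop :=
  ∀ l, ∀ a ∈ v, FinTree.At a l .bot → ∃ a' ∈ v, ∃ t, FinTree.At a' l t ∧ t ≠ .bot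

namespace BotFree

theorem exists_ne_bot {v : Val L} (h : v.BotFree) : ∃ a ∈ v, a ≠ .bot := by
  obtain ⟨a, ha, t, hat, ht⟩ := h [] .bot (Ideal.bot_mem v) (.here _)
  cases hat
  exact ⟨a, ha, ht⟩

theorem unCon {v : Val L} (h : v.BotFree) {c : L.Con} {p : L.OddPrio} {u : FinTree L}
    (hu : FinTree.con c p u ∈ v) : (v.unCon c p).BotFree := by
  intro l a ha hal
  obtain ⟨a', ha', t, hat, ht⟩ := h _ _ ((mem_unCon hu).1 ha) (.con c p hal)
  obtain ⟨e, -, h1, h2⟩ := v.directed _ hu a' ha'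
  obtain ⟨e, rfl, -⟩ := FinTree.con_le_iff.1 h1
  -- `a'` is not `⊥` because a non-empty path starts at its root; being below `con c p e`, it has
  -- the same constructor.
  obtain ⟨b, rfl⟩ := FinTree.le_con h2 (by rintro rfl; cases hat)
  cases hat with | con _ _ hat => exact ⟨b, (mem_unCon hu).2 ha', t, hat, ht⟩

theorem unStr {v : Val L} (h : v.BotFree) {s : Set L.Des} {p : L.EvenPrio} {u : s → FinTree L}
    (hu : FinTree.str s p u ∈ v) (d : s) : (v.unStr s p d).BotFree := by
  intro l a ha hal
  obtain ⟨f, hf, rfl⟩ := (mem_unStr hu).1 ha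
  obtain ⟨a', ha', t, hat, ht⟩ := h _ _ hf (.str s p d hal)
  obtain ⟨e, -, h1, h2⟩ := v.directed _ hu a' ha'
  obtain ⟨e, rfl, -⟩ := FinTree.str_le_iff.1 h1
  obtain ⟨b, rfl⟩ := FinTree.le_str h2 (by rintro rfl; cases hat)
  -- Case analysis on `hat` would have to unify `d.1` with the underlying destructor of another
  -- field. Naming the step turns this into an equation, from which the equality of the two fields
  -- is recovered.
  generalize hst : ((some d.1, p.1) : FinTree.Step L) = st at hat
  cases hat with
  | str _ _ d' hat =>
    obtain rfl : d = d' := Subtype.ext (by simpa using hst)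
    exact ⟨_, (mem_unStr hu).2 ⟨b, ha', rfl⟩, t, hat, ht⟩

/-- A value without `⊥` leaves no room for a strictly larger one. The root of `v` is defined and
agrees with that of `a` by directedness of `w`; the components of `v` are again without `⊥`, so the
induction on `a` continues in them, with `v` and `w` generalised. -/
theorem mem_of_le (a : FinTree L) :
    ∀ {v w : Val L}, v.BotFree → v ≤ w → a ∈ w → a ∈ v := by
  induction a with
  | bot => exact fun _ _ _ => Ideal.bot_mem _
  | atom x =>
    intro v w hv hvw ha
    obtain ⟨b, hb, hne⟩ := hv.exists_ne_bot
    obtain ⟨e, -, h1, h2⟩ := w.directed _ ha b (hvw hb)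
    obtain rfl := FinTree.atom_le_iff.1 h1
    exact FinTree.le_atom h2 hne ▸ hb
  | con c p t ih =>
    intro v w hv hvw ha
    obtain ⟨b, hb, hne⟩ := hv.exists_ne_bot
    obtain ⟨e, -, h1, h2⟩ := w.directed _ ha b (hvw hb)
    obtain ⟨e, rfl, -⟩ := FinTree.con_le_iff.1 h1
    obtain ⟨b, rfl⟩ := FinTree.le_con h2 hne
    refine (mem_unCon hb).1 (ih (hv.unCon hb) ?_ ((mem_unCon ha).2 ha))
    rintro t' ⟨a', ha', h⟩
    exact ⟨a', hvw ha', h⟩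
  | str s p t ih =>
    intro v w hv hvw ha
    obtain ⟨b, hb, hne⟩ := hv.exists_ne_bot
    obtain ⟨e, -, h1, h2⟩ := w.directed _ ha b (hvw hb)
    obtain ⟨e, rfl, -⟩ := FinTree.str_le_iff.1 h1
    obtain ⟨b, rfl⟩ := FinTree.le_str h2 hne
    -- The induction hypothesis treats one field at a time: each field `d` gets its own
    -- approximation of `v`, correct at `d` only. They are merged below, which uses that there are
    -- finitely many destructors.
    have h : ∀ d, ∃ f, FinTree.str s p f ∈ v ∧ f d = t d := by
      intro d
      refine (mem_unStr hb).1 (ih d (hv.unStr hb d) ?_ ((mem_unStr ha).2 ⟨t, ha, rfl⟩))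
      rintro t' ⟨a', ha', h⟩
      exact ⟨a', hvw ha', h⟩
    choose f hf hft using h
    obtain ⟨m, hm, hfm⟩ := exists_upper_bound v (fun d => FinTree.str s p (f d)) hf
    -- Going above `b` as well ensures that the bound is a record even when `s` is empty, in which
    -- case `m` is arbitrary.
    obtain ⟨e, he, h3, h4⟩ := v.directed _ hb m hm
    obtain ⟨g, rfl, -⟩ := FinTree.str_le_iff.1 h3
    refine v.lower (FinTree.str_mono s p fun d => ?_) he
    obtain ⟨g', hg', h⟩ := FinTree.str_le_iff.1 ((hfm d).trans h4)
    cases hg'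
    exact hft d ▸ h d

end BotFree

/-- Absence of `⊥`, the first half of totality, already forces maximality. -/
theorem Total.eq_of_le {κ : Convention} {v w : Val L} (hv : v.Total κ) (h : v ≤ w) : v = w :=
  le_antisymm h fun a ha => BotFree.mem_of_le a hv.1 h ha

end Val

/-! ### Simple values inside `𝒮`. -/

theorem Sums.simple_le_simple {v w : Val L} : Sums.simple v ≤ Sums.simple w ↔ v ≤ w := by
  refine ⟨fun h a ha => ?_, fun h => Sums.simple_mono h⟩
  obtain ⟨b, hb, hab⟩ := h ⟨a, ha, Ideal.mem_principal_self⟩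
  obtain ⟨a', ha', hle⟩ := hab b (Finset.mem_singleton_self b)
  obtain rfl := Finset.mem_singleton.1 ha'
  exact w.lower hle hb

/-- `Sums.Summand` also counts the values above `v`; maximality of `v` leaves only `v` itself. -/
theorem Sums.Total.simple {κ : Convention} {v : Val L} (hv : v.Total κ) :
    (Sums.simple v).Total κ := by
  intro w hw
  exact hv.eq_of_le (Sums.simple_le_simple.1 hw) ▸ hv

/-! ### Comparison of the two semantics -/

theorem SumsFun.con_simple (c : L.Con) (p : L.OddPrio) (v : Val L) :
    (SumsFun.con c p).toFun (Sums.simple v) ≤ Sums.simple (v.con c p) := by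
  refine (SumsFun.lin_simple _ _ v).trans_le ?_
  rintro C ⟨a, ha, hC⟩
  exact ⟨_, ⟨a, ha, Ideal.mem_principal_self⟩, hC⟩

/-- The multilinear expansion may have many terms, but in the Smyth order a single term below a
given record is enough. -/
theorem Sums.str_simple (s : Set L.Des) (p : L.EvenPrio) (v : s → Val L) :
    Sums.str s p (fun d => Sums.simple (v d)) ≤ Sums.simple (Val.str s p v) := by
  rintro C ⟨K, hK, hC⟩
  choose a ha hKa using hK
  refine ⟨_, ⟨a, ha, le_rfl⟩, Ideal.mem_principal.2 (hC.trans ?_)⟩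
  intro b hb
  obtain rfl := Finset.mem_singleton.1 hb
  -- `k d` is a term of `K d` below `a d`; the record made of these is the required term of the
  -- expansion.
  choose k hk hka using fun d => hKa d (a d) (Finset.mem_singleton_self _)
  exact ⟨_, FinSum.mem_str.2 ⟨k, hk, rfl⟩, FinTree.str_mono s p hka⟩

/-- Typing is essential: `SumsFun.projFin` gives `𝟎` on atoms, constructors and records lacking the
field, and `𝟎` is not below a simple value. None of these shapes has a codata type containing `d`.
-/
theorem SumsFun.proj_simple (T : L.Codata) (args : Fin (L.cArity T) → L.Typ) (d : L.Field T)
    (v : Den (.codata T args)) :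
    (SumsFun.proj ⟨T, d⟩).toFun (Sums.simple v.1) ≤ Sums.simple (v.proj T args d).1 := by
  refine (SumsFun.lin_simple _ _ v.1).trans_le ?_
  rintro C ⟨a, ha, hC⟩
  cases a with
  | bot => exact (bot_le : ⊥ ≤ Sums.simple (v.proj T args d).1) hC
  | atom x => exact absurd (v.2 _ ha) (by simp [FinTree.HasType])
  | con c p t =>
    obtain ⟨args', h, -⟩ := v.2 _ ha
    cases h
  | str s p t =>
    -- `FinTree.unStr` tests the field set and the priority, whereas `SumsFun.projFin` tests only
    -- the presence of the field. The type fixes both, so the two projections agree here.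
    obtain ⟨T', args', rfl, h, rfl, -⟩ := v.2 _ ha
    cases h
    have hd : (⟨T, d⟩ : L.Des) ∈ L.fields T := rfl
    rw [SumsFun.projFin, dif_pos hd] at hC
    refine ⟨t ⟨_, hd⟩, ⟨_, ha, ?_⟩, hC⟩
    simp [FinTree.unStr, Lang.field]

/-- Both semantics thus evaluate a right-hand side in the same environment. -/
theorem Pat.unifierDen_val {τ : L.Typ} (p : Pat L τ) :
    ∀ (v : Den τ) (x : p.Var), (p.unifierDen v x).1 = p.unifier v.1 x := by
  induction p with
  | var τ => exact fun _ _ => rfl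
  | con T args c p ih => exact fun v x => ih (v.unCon T args c) x
  | str T args ps ih => exact fun v x => ih x.1 (v.proj T args x.1) x.2

/-! ### Right-hand sides of clauses. -/

variable {A B : L.Typ}

/-- Induction on the term: each operation of `𝒮` is monotone, and on a typed simple value it is at
most its typed counterpart. For calls this is `hσ` followed by `SumsFun.hat_simple`; for recursive
calls, `SumsFun.hat_simple` alone. -/
theorem Tm.sem_le_den {X : Type} {Γ : X → L.Typ} {ρ : ∀ g, DenFun (L.dom g) (L.cod g)}
    {σ : L.Fn → SumsFun L} (hσ : ∀ g, σ g ≤ SumsFun.hat (ρ g)) (f : DenFun A B)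
    (s : ∀ x, Den (Γ x)) {τ : L.Typ} (u : Tm L A B Γ τ) :
    u.sem σ (SumsFun.hat f) (fun x => Sums.simple (s x).1) ≤ Sums.simple (u.den ρ f s).1 := by
  induction u with
  | var x => exact le_rfl
  | con T args c u ih =>
    exact ((SumsFun.con _ _).cont.monotone ih).trans (SumsFun.con_simple _ _ _)
  | str T args u ih =>
    exact (Sums.str_le _ _ fun d => ih _).trans (Sums.str_simple _ _ _)
  | proj T args d u ih =>
    exact ((SumsFun.proj _).cont.monotone ih).trans (SumsFun.proj_simple T args d _)
  | call g u ih =>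
    exact ((σ g).cont.monotone ih).trans ((hσ g _).trans_eq (SumsFun.hat_simple (ρ g) _))
  | self u ih =>
    exact ((SumsFun.hat f).cont.monotone ih).trans_eq (SumsFun.hat_simple f _)

/-! ### Sums over all clauses against the choice of the first one. -/

theorem Clauses.sumAll_le_sem (σ : L.Fn → SumsFun L) (f : SumsFun L) {cs : Clauses L A B}
    (v : Val L) {c : Clause L A B} (hc : c ∈ cs) : cs.sumAll σ f v ≤ c.sem σ f v := by
  obtain ⟨i, rfl⟩ := List.get_of_mem hc
  exact fun _ hC => hC i

/-- As long as some clause does not refuse `v`, one of the clauses is below the result of the first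
one that does not. -/
theorem Clauses.exists_sem_le_firstMatch {ρ : ∀ g, DenFun (L.dom g) (L.cod g)}
    {σ : L.Fn → SumsFun L} (hσ : ∀ g, σ g ≤ SumsFun.hat (ρ g)) (f : DenFun A B) (v : Den A)
    (cs : Clauses L A B) (h : ∃ c ∈ cs, ¬ c.pat.Fails v.1) :
    ∃ c ∈ cs, c.sem σ (SumsFun.hat f) v.1 ≤ Sums.simple (firstMatch ρ f v cs).1 := by
  induction cs with
  | nil => simp at h
  | cons c cs ih =>
    by_cases h1 : c.pat.Fails v.1
    · obtain ⟨c', hc', h'⟩ := ih (by simpa [h1] using h)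
      refine ⟨c', List.mem_cons_of_mem _ hc', ?_⟩
      rwa [firstMatch, if_pos h1]
    · refine ⟨c, List.mem_cons_self, ?_⟩
      rw [firstMatch, if_neg h1, Clause.sem, if_neg h1]
      by_cases h2 : c.pat.Matches v.1
      · rw [if_pos h2, if_pos h2]
        have := c.rhs.sem_le_den hσ f (c.pat.unifierDen v)
        simpa only [Pat.unifierDen_val] using this
      -- Here `v` is not defined enough for the head: its contribution is `⊥`, below anything.
      · rw [if_neg h2]
        exact bot_le

/-- Both sides are linear extensions, so finite simple values suffice. On an ill-typed one the right
side is `𝟎`; on a typed one the sum is at most the contribution of the clause supplied by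
exhaustiveness. -/
theorem Clauses.ndt_hat_le {cs : Clauses L A B} (hcs : cs.Exhaustive)
    {ρ : ∀ g, DenFun (L.dom g) (L.cod g)} {σ : L.Fn → SumsFun L}
    (hσ : ∀ g, σ g ≤ SumsFun.hat (ρ g)) (f : DenFun A B) :
    cs.ndt σ (SumsFun.hat f) ≤ SumsFun.hat (cs.std ρ f) := by
  refine SumsFun.lin_mono (hF := cs.sumAll_mono σ _) fun a => ?_
  by_cases ha : a.HasType A
  · rw [SumsFun.hatFin, dif_pos ha]
    obtain ⟨c, hc, h⟩ := exists_sem_le_firstMatch hσ f (Den.fin a ha) cs (hcs _)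
    exact (sumAll_le_sem σ _ _ hc).trans h
  · rw [SumsFun.hatFin, dif_neg ha]
    exact le_top

/-! ### Iterates and fixed points. -/

theorem SumsFun.hat_mono {f g : DenFun A B} (h : f ≤ g) : hat f ≤ hat g := by
  refine lin_mono fun a => ?_
  by_cases ha : a.HasType A
  · rw [hatFin, hatFin, dif_pos ha, dif_pos ha]
    exact Sums.simple_mono (h (Den.fin a ha))
  · rw [hatFin, hatFin, dif_neg ha, dif_neg ha]

theorem Clauses.iterate_ndt_le {cs : Clauses L A B} (hcs : cs.Exhaustive)
    {ρ : ∀ g, DenFun (L.dom g) (L.cod g)} {σ : L.Fn → SumsFun L}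
    (hσ : ∀ g, σ g ≤ SumsFun.hat (ρ g)) (n : ℕ) :
    (cs.ndt σ)^[n] SumsFun.daimon ≤ SumsFun.hat ((cs.std ρ)^[n] ⊥) := by
  induction n with
  | zero => exact SumsFun.daimon_le _
  | succ n ih =>
    rw [Function.iterate_succ_apply', Function.iterate_succ_apply']
    exact ((cs.ndt σ).monotone ih).trans (ndt_hat_le hcs hσ _)

/-- The non-deterministic semantics is below the standard one. -/
theorem Clauses.fixNdt_le_hat_fixStd {cs : Clauses L A B} (hcs : cs.Exhaustive)
    {ρ : ∀ g, DenFun (L.dom g) (L.cod g)} {σ : L.Fn → SumsFun L}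
    (hσ : ∀ g, σ g ≤ SumsFun.hat (ρ g)) : cs.fixNdt σ ≤ SumsFun.hat (cs.fixStd ρ) :=
  -- Each iterate is bounded separately by the lifting of the whole supremum, so monotonicity of
  -- `SumsFun.hat` is enough and its continuity is not needed.
  ωSup_le _ _ fun n => (iterate_ndt_le hcs hσ n).trans (SumsFun.hat_mono
    (le_ωSup (fixedPoints.iterateChain (cs.std ρ) ⊥ bot_le) n))

end Chariot

theorem mainTheorem2 (L : Chariot.Lang) (κ : Chariot.Convention) (A B : L.Typ)
    (cs : Chariot.Clauses L A B) (hcs : cs.Exhaustive)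
    (ρ : ∀ g : L.Fn, Chariot.DenFun (L.dom g) (L.cod g))
    (σ : L.Fn → Chariot.SumsFun L) (hσ : ∀ g, σ g ≤ Chariot.SumsFun.hat (ρ g))
    (h : (cs.fixNdt σ).Total κ) :
    (cs.fixStd ρ).Total κ := by
  intro v hv
  -- The remaining goal is that the standard result is a summand of the non-deterministic one, which
  -- unfolds to an inequality in `𝒮`.
  refine h _ (Chariot.Sums.Total.simple hv) _ ?_
  exact (Chariot.Clauses.fixNdt_le_hat_fixStd hcs hσ _).trans_eq
    (Chariot.SumsFun.hat_simple _ v)
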